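/- Let $W$ be a standard real Wiener process on $[0,T]$, $T\in(0,\infty)$, with respect to a filtration $(\mathcal F_t)$ on a probability space $(\Omega,\mathcal F,\mathbb P)$. For $p\in[2,\infty)$ and $\sigma\in(0,1)$, the space $W^{1+\sigma,p}(0,T)$ consists of the $g\in L^p(0,T)$ which have a weak derivative $\dot g$ and for which $$\|g\|_{W^{1+\sigma,p}(0,T)}=\Big(\int_0^T|g(t)|^p\,dt+\int_0^T|\dot g(t)|^p\,dt+\int_0^T\!\!\int_0^T\frac{|\dot g(t)-\dot g(s)|^p}{|t-s|^{1+\sigma p}}\,dt\,ds\Big)^{1/p}<\infty .$$ There is a constant $C_p\in(0,\infty)$, depending only on $p\in[2,\infty)$ and not larger than any constant $K>0$ that is admissible in the discrete-time Burkholder–Davis–Gundy inequality $$\Big\|\max_{i\le n}|X_i|\Big\|_{L^p}\le K\,\Big\|\Big(|X_0|^2+\sum_{i<n}|X_{i+1}-X_i|^2\Big)^{1/2}\Big\|_{L^p}\qquad\text{(all real discrete-time martingales $X$, all $n$)}$$ (so that every such $K$ may be used as $C_p$ below), with the following property. Let $\sigma\in(0,1)$, $\theta\in[0,1]$, and let $g\in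 W^{1+\sigma,p}(0,T)$ be deterministic. Then $g$ has a continuous representative on $[0,T]$ and the Itô integral $I[g]=\int_0^T g(t)\,dW(t)$ exists. For $N\in\{1,2,\dots\}$ put $h=T/N$, $t_j=jh$, $t_{j-1/2}=\frac12(t_{j-1}+t_j)$, $\theta_j=t_{j-1}+\theta h$, $\hat\theta_j=t_{j-1}+(1-\theta)h$, and, with $g$ evaluated through its continuous representative, $$Q^{\mathrm{Trap}}_N[g]=\sum_{j=1}^N\tfrac12\big(g(\theta_j)+g(\hat\theta_j)\big)\big(W(t_j)-W(t_{j-1})\big)+\sum_{j=1}^N\tfrac1h\big(g(t_j)-g(t_{j-1})\big)\int_{t_{j-1}}^{t_j}(t-t_{j-1/2})\,dW(t)$$ ($\theta=0$: trapezoidal rule, $\theta=\frac12$: midpoint rule), where the Itô integrals in the last sum exist as well. Then for every $N\in\{1,2,\dots\}$ $$\big\|I[g]-Q^{\mathrm{Trap}}_N[g]\big\|_{L^p(\Omega)}\le C_p\,\big(2p(p-1)\big)^{1/2}\,T^{\frac{p-2}{2p}}\,h^{1+\sigma}\,\|g\|_{W^{1+\sigma,p}(0,T)} ,$$ that is, the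 rule converges with order $1+\sigma$. -/

import Mathlib

open MeasureTheory ProbabilityTheory Filter Topology

noncomputable section

/-! ### Wiener processes and the Itô integral -/

/-- `W`, restricted to the time interval `[0, T]`, is a standard real Wiener process with respect
to the filtration `𝓕` on the probability space `(Ω, P)`. Only the times in `[0, T]` matter. -/
structure IsWienerProcessOn {Ω : Type*} {mΩ : MeasurableSpace Ω} (T : ℝ)
    (𝓕 : Filtration ℝ mΩ) (W : ℝ → Ω → ℝ) (P : Measure Ω) : Prop where
  adapted : ∀ t ∈ Set.Icc 0 T, Measurable[𝓕 t] (W t)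
  zero : ∀ᵐ ω ∂P, W 0 ω = 0
  gaussian_increments : ∀ s t : ℝ, 0 ≤ s → s ≤ t → t ≤ T →
    HasLaw (fun ω => W t ω - W s ω) (gaussianReal 0 (t - s).toNNReal) P
  indep_increments : ∀ s t : ℝ, 0 ≤ s → s ≤ t → t ≤ T →
    Indep (MeasurableSpace.comap (fun ω => W t ω - W s ω) inferInstance) (𝓕 s) P
  continuous_paths : ∀ᵐ ω ∂P, ContinuousOn (fun t => W t ω) (Set.Icc 0 T)

/-- A simple (elementary predictable) process on `(a, b]`, that is, a finite sum
`∑ i, ξ i • 1_{(l i, r i]}` with `a ≤ l i ≤ r i ≤ b` and bounded `𝓕 (l i)`-measurable `ξ i`.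
The intervals may overlap. -/
structure SimpleProcess {Ω : Type*} {mΩ : MeasurableSpace Ω} (𝓕 : Filtration ℝ mΩ)
    (a b : ℝ) where
  /-- the number of terms -/
  n : ℕ
  /-- the left end points -/
  l : Fin n → ℝ
  /-- the right end points -/
  r : Fin n → ℝ
  /-- the coefficients -/
  ξ : Fin n → Ω → ℝ
  a_le : ∀ i, a ≤ l i
  l_le_r : ∀ i, l i ≤ r i
  r_le : ∀ i, r i ≤ b
  measurable_ξ : ∀ i, Measurable[𝓕 (l i)] (ξ i)
  bounded_ξ : ∀ i, ∃ K : ℝ, ∀ ω, |ξ i ω| ≤ K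

/-- The value at time `t` of a simple process. -/
def SimpleProcess.val {Ω : Type*} {mΩ : MeasurableSpace Ω} {𝓕 : Filtration ℝ mΩ} {a b : ℝ}
    (S : SimpleProcess 𝓕 a b) (t : ℝ) (ω : Ω) : ℝ :=
  ∑ i, (Set.Ioc (S.l i) (S.r i)).indicator (fun _ => S.ξ i ω) t

/-- The elementary stochastic integral `∑ i, ξ i * (W (r i) - W (l i))` of a simple process. -/
def SimpleProcess.integral {Ω : Type*} {mΩ : MeasurableSpace Ω} {𝓕 : Filtration ℝ mΩ} {a b : ℝ}
    (S : SimpleProcess 𝓕 a b) (W : ℝ → Ω → ℝ) (ω : Ω) : ℝ :=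
  ∑ i, S.ξ i ω * (W (S.r i) ω - W (S.l i) ω)

/-- `X` is (a version of) the Itô integral `∫_a^b G(t) dW(t)` of the square-integrable process `G`:
there are simple processes converging to `G` in `L²((a, b] × Ω)` whose elementary
integrals converge to `X` in `L²(Ω)`. -/
def IsItoIntegral {Ω : Type*} {mΩ : MeasurableSpace Ω} (𝓕 : Filtration ℝ mΩ) (W : ℝ → Ω → ℝ)
    (P : Measure Ω) (a b : ℝ) (G : ℝ → Ω → ℝ) (X : Ω → ℝ) : Prop :=
  MemLp (fun q : ℝ × Ω => G q.1 q.2) 2 ((volume.restrict (Set.Ioc a b)).prod P) ∧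
  MemLp X 2 P ∧
  ∃ S : ℕ → SimpleProcess 𝓕 a b,
    Tendsto (fun n => eLpNorm (fun q : ℝ × Ω => (S n).val q.1 q.2 - G q.1 q.2) 2
      ((volume.restrict (Set.Ioc a b)).prod P)) atTop (𝓝 0) ∧
    Tendsto (fun n => eLpNorm (fun ω => (S n).integral W ω - X ω) 2 P) atTop (𝓝 0)

/-- The process `G` has an Itô integral `∫_a^b G(t) dW(t)`. -/
def ItoIntegrable {Ω : Type*} {mΩ : MeasurableSpace Ω} (𝓕 : Filtration ℝ mΩ) (W : ℝ → Ω → ℝ)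
    (P : Measure Ω) (a b : ℝ) (G : ℝ → Ω → ℝ) : Prop :=
  ∃ X : Ω → ℝ, IsItoIntegral 𝓕 W P a b G X

open Classical in
/-- The Itô integral `∫_a^b G(t) dW(t)` (a version of it; `0` if `G` is not integrable). -/
def itoIntegral {Ω : Type*} {mΩ : MeasurableSpace Ω} (𝓕 : Filtration ℝ mΩ) (W : ℝ → Ω → ℝ)
    (P : Measure Ω) (a b : ℝ) (G : ℝ → Ω → ℝ) : Ω → ℝ :=
  if h : ItoIntegrable 𝓕 W P a b G then h.choose else 0

/-! ### Fractional Sobolev spaces of order `1 + σ` on `(0, T)` -/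

/-- `w` is a weak derivative of `v` on `(0, T)`. -/
def HasWeakDeriv (T : ℝ) (v w : ℝ → ℝ) : Prop :=
  LocallyIntegrableOn v (Set.Ioo 0 T) ∧ LocallyIntegrableOn w (Set.Ioo 0 T) ∧
  ∀ φ : ℝ → ℝ, ContDiff ℝ ((⊤ : ℕ∞) : WithTop ℕ∞) φ → HasCompactSupport φ →
    tsupport φ ⊆ Set.Ioo 0 T →
    ∫ t in Set.Ioo 0 T, v t * deriv φ t = - ∫ t in Set.Ioo 0 T, w t * φ t

open Classical in
/-- The weak derivative of `v` on `(0, T)` (unique almost everywhere; `0` if there is none). -/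
def weakDeriv (T : ℝ) (v : ℝ → ℝ) : ℝ → ℝ :=
  if h : ∃ w, HasWeakDeriv T v w then h.choose else 0

/-- The Sobolev-Slobodeckij norm of `W^{1+σ,p}(0,T)`, with values in `[0, ∞]`:
`(∫ |v|^p + ∫ |v'|^p + ∫∫ |v'(t) - v'(s)|^p / |t - s|^{1+σp} dt ds)^{1/p}`. -/
def slobodeckijNorm (σ p T : ℝ) (v : ℝ → ℝ) : ENNReal :=
  ((∫⁻ t in Set.Ioo 0 T, ENNReal.ofReal (|v t| ^ p)) +
   (∫⁻ t in Set.Ioo 0 T, ENNReal.ofReal (|weakDeriv T v t| ^ p)) +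
   ∫⁻ s in Set.Ioo 0 T, ∫⁻ t in Set.Ioo 0 T,
     ENNReal.ofReal (|weakDeriv T v t - weakDeriv T v s| ^ p / |t - s| ^ (1 + σ * p))) ^ (1 / p)

/-- `v` is an element of `W^{1+σ,p}(0,T)`. -/
def MemSlobodeckij (σ p T : ℝ) (v : ℝ → ℝ) : Prop :=
  MemLp v (ENNReal.ofReal p) (volume.restrict (Set.Ioo 0 T)) ∧
  (∃ w, HasWeakDeriv T v w) ∧ slobodeckijNorm σ p T v < ⊤

/-- `f` is a continuous representative on `[0, T]` of the equivalence class of `g`. -/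
def IsContinuousRepresentative (T : ℝ) (g f : ℝ → ℝ) : Prop :=
  ContinuousOn f (Set.Icc 0 T) ∧ f =ᵐ[volume.restrict (Set.Ioo 0 T)] g

/-! ### The generalized stochastic trapezoidal rule -/

/-- The grid point `t_j = j h`, where `h = T / N`. -/
def gridPoint (T : ℝ) (N j : ℕ) : ℝ := j * (T / N)

/-- The cell integral `∫_{t_j}^{t_{j+1}} (t - (t_j + t_{j+1}) / 2) dW(t)`. -/
def cellIntegral {Ω : Type*} {mΩ : MeasurableSpace Ω} (𝓕 : Filtration ℝ mΩ) (W : ℝ → Ω → ℝ)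
    (P : Measure Ω) (T : ℝ) (N j : ℕ) : Ω → ℝ :=
  itoIntegral 𝓕 W P (gridPoint T N j) (gridPoint T N (j + 1))
    (fun t _ => t - (gridPoint T N j + gridPoint T N (j + 1)) / 2)

/-- The generalized stochastic trapezoidal rule with parameter `θ` and `N` steps. The cells are
`[t_j, t_{j+1}]` with `j = 0, …, N - 1`. -/
def trapezoidalRule {Ω : Type*} {mΩ : MeasurableSpace Ω} (𝓕 : Filtration ℝ mΩ) (W : ℝ → Ω → ℝ)
    (P : Measure Ω) (T θ : ℝ) (N : ℕ) (g : ℝ → ℝ) (ω : Ω) : ℝ :=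
  (∑ j ∈ Finset.range N,
    1 / 2 * (g (gridPoint T N j + θ * (T / N)) + g (gridPoint T N j + (1 - θ) * (T / N))) *
      (W (gridPoint T N (j + 1)) ω - W (gridPoint T N j) ω)) +
  ∑ j ∈ Finset.range N,
    1 / (T / N) * (g (gridPoint T N (j + 1)) - g (gridPoint T N j)) * cellIntegral 𝓕 W P T N j ω

/-! ### The constant of the discrete-time Burkholder-Davis-Gundy inequality -/

/-- `K` is an admissible constant in the upper discrete-time Burkholder-Davis-Gundy inequality:
`‖max_{i ≤ n} |X i|‖_{L^p} ≤ K ‖[X]_n^{1/2}‖_{L^p}` for every discrete-time martingale, where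
`[X]_n = |X 0|² + ∑_{i < n} |X (i+1) - X i|²`. -/
def IsUpperBDGConstant (p K : ℝ) : Prop :=
  0 < K ∧ ∀ (Ω : Type) (mΩ : MeasurableSpace Ω) (P : Measure Ω) (_ : IsProbabilityMeasure P)
    (𝓕 : Filtration ℕ mΩ) (X : ℕ → Ω → ℝ), Martingale X 𝓕 P → ∀ n : ℕ,
    eLpNorm (fun ω => (Finset.range (n + 1)).sup' Finset.nonempty_range_add_one
        (fun i => |X i ω|)) (ENNReal.ofReal p) P ≤
      ENNReal.ofReal K * eLpNorm (fun ω => √(|X 0 ω| ^ 2 +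
        ∑ i ∈ Finset.range n, |X (i + 1) ω - X i ω| ^ 2)) (ENNReal.ofReal p) P

end

/-! The Burkholder–Davis–Gundy inequality is not needed. Every admissible `K` is at least `1`, as
the constant martingale `1` shows, so `C p = 1` is allowed. Since `g` is deterministic, the error is
`∫ e dW` with `e` the difference of `g` and a function that is affine on each cell. It is therefore
a centred Gaussian variable, whose `L^p` norm is at most `√p` times its standard deviation, and `√p
≤ (2p(p-1))^{1/2}` for `p ≥ 2`.

The deterministic part bounds `∫ e²`. By du Bois-Reymond, `g` is a.e. a primitive of its weak
derivative `w`. On a cell of length `h` the slope of the affine function is the mean `m` of `w`, and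
its two nodes are symmetric about the midpoint; hence `|e| ≤ ∫ |w - m| ≤ h⁻¹ ∬ |w t - w s|`.
Hölder's inequality and `|t - s| ≤ h` turn this into `h^{1+σ-1/p} E_j^{1/p}`, where `E_j` is the
Slobodeckij double integral over the square of the cell (`abs_sub_interpolation_le`). The power mean
inequality sums the squares over the cells and produces `T^{(p-2)/(2p)}` (`sum_mul_sq_rpow_le`).

The Itô integrals are arbitrary `L²` limits of elementary integrals. The isometry shows that Riemann
sums converge to every version. For Riemann sums the error is a finite sum of independent Gaussian
increments, and the resulting bound passes to the limit because `L^p` norms are lower semicontinuous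
under convergence in measure (`IsWienerProcessOn.eLpNorm_itoIntegral_sub_affine_le`). -/

/-! ### Functions with an integrable weak derivative -/

/-- A smooth function with integral zero and compact support in `(0, T)` is the derivative of
such a function. -/
theorem exists_primitive_hasCompactSupport {T : ℝ} {η : ℝ → ℝ}
    (hη : ContDiff ℝ ((⊤ : ℕ∞) : WithTop ℕ∞) η) (hc : HasCompactSupport η)
    (hs : tsupport η ⊆ Set.Ioo 0 T) (h0 : ∫ x, η x = 0) :
    ∃ φ : ℝ → ℝ, ContDiff ℝ ((⊤ : ℕ∞) : WithTop ℕ∞) φ ∧ HasCompactSupport φ ∧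
      tsupport φ ⊆ Set.Ioo 0 T ∧ deriv φ = η := by
  obtain hem | hne := (tsupport η).eq_empty_or_nonempty
  · have : η = 0 := by
      funext x
      exact image_eq_zero_of_notMem_tsupport (by simp [hem])
    refine ⟨0, contDiff_const, HasCompactSupport.zero, by simp [tsupport], ?_⟩
    rw [this]; exact deriv_const' 0
  -- With `a` and `b` the extreme points of the support, the primitive from `a` vanishes left of
  -- `a`, and right of `b` because the total integral is zero.
  obtain ⟨a, ha, ha'⟩ := (show IsCompact (tsupport η) from hc).exists_isLeast hne
  obtain ⟨b, hb, hb'⟩ := (show IsCompact (tsupport η) from hc).exists_isGreatest hne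
  have hint : Integrable η := hη.continuous.integrable_of_hasCompactSupport hc
  have hlo : ∀ x < a, η x = 0 := fun x hx =>
    image_eq_zero_of_notMem_tsupport fun h => absurd (ha' h) (not_le.2 hx)
  have hhi : ∀ x, b < x → η x = 0 := fun x hx =>
    image_eq_zero_of_notMem_tsupport fun h => absurd (hb' h) (not_le.2 hx)
  have hd : ∀ x, HasDerivAt (fun x => ∫ t in a..x, η t) (η x) x := fun x =>
    intervalIntegral.integral_hasDerivAt_right hint.intervalIntegrable
      hη.continuous.aestronglyMeasurable.stronglyMeasurableAtFilter hη.continuous.continuousAt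
  have hderiv : deriv (fun x => ∫ t in a..x, η t) = η := funext fun x => (hd x).deriv
  have hzl : ∀ x ≤ a, ∫ t in a..x, η t = 0 := by
    intro x hx
    rw [intervalIntegral.integral_symm, neg_eq_zero]
    refine intervalIntegral.integral_zero_ae ?_
    filter_upwards [compl_mem_ae_iff.2 (measure_singleton a)] with t ht ht'
    rw [Set.uIoc_of_le hx] at ht'
    exact hlo t (lt_of_le_of_ne ht'.2 ht)
  have hzr : ∀ x, b ≤ x → ∫ t in a..x, η t = 0 := by
    intro x hx
    have hab : a ≤ b := ha' hb
    rw [intervalIntegral.integral_of_le (hab.trans hx), ← integral_Icc_eq_integral_Ioc,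
      setIntegral_eq_integral_of_forall_compl_eq_zero, h0]
    intro t ht
    rw [Set.mem_Icc, not_and_or, not_le, not_le] at ht
    rcases ht with ht | ht
    · exact hlo t ht
    · exact hhi t (hx.trans_lt ht)
  have hsupp : tsupport (fun x => ∫ t in a..x, η t) ⊆ Set.Icc a b := by
    refine closure_minimal (fun x hx => ?_) isClosed_Icc
    by_contra hx'
    rw [Set.mem_Icc, not_and_or, not_le, not_le] at hx'
    rcases hx' with h | h
    · exact hx (hzl x h.le)
    · exact hx (hzr x h.le)
  refine ⟨fun x => ∫ t in a..x, η t, ?_, ?_, ?_, hderiv⟩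
  · rw [contDiff_infty_iff_deriv, hderiv]
    exact ⟨fun x => (hd x).differentiableAt, hη⟩
  · exact isCompact_Icc.of_isClosed_subset (isClosed_tsupport _) hsupp
  · exact hsupp.trans fun x hx => ⟨(hs ha).1.trans_le hx.1, hx.2.trans_lt (hs hb).2⟩

/-- The lemma of du Bois-Reymond. -/
theorem ae_eq_const_of_integral_mul_deriv_eq_zero {T : ℝ} (hT : 0 < T) {u : ℝ → ℝ}
    (hu : IntegrableOn u (Set.Ioo 0 T))
    (h : ∀ φ : ℝ → ℝ, ContDiff ℝ ((⊤ : ℕ∞) : WithTop ℕ∞) φ → HasCompactSupport φ →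
      tsupport φ ⊆ Set.Ioo 0 T → ∫ t in Set.Ioo 0 T, u t * deriv φ t = 0) :
    ∃ c, u =ᵐ[volume.restrict (Set.Ioo 0 T)] fun _ => c := by
  let B : ContDiffBump (T / 2) := ⟨T / 8, T / 4, by positivity, by linarith⟩
  let χ : ℝ → ℝ := B.normed volume
  have hχ : ContDiff ℝ ((⊤ : ℕ∞) : WithTop ℕ∞) χ := B.contDiff_normed
  have hχc : HasCompactSupport χ := B.hasCompactSupport_normed
  have hχs : tsupport χ ⊆ Set.Ioo 0 T := by
    rw [B.tsupport_normed_eq, Real.closedBall_eq_Icc]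
    intro x hx
    have h1 : T / 2 - T / 4 ≤ x := hx.1
    have h2 : x ≤ T / 2 + T / 4 := hx.2
    constructor <;> linarith
  have hχ1 : ∫ x, χ x = 1 := B.integral_normed
  have hbd : ∀ ψ : ℝ → ℝ, Continuous ψ → HasCompactSupport ψ →
      IntegrableOn (fun t => u t * ψ t) (Set.Ioo 0 T) := by
    intro ψ hψ hψc
    obtain ⟨K, hK⟩ := hψ.bounded_above_of_compact_support hψc
    exact hu.mul_bdd hψ.aestronglyMeasurable (Eventually.of_forall hK)
  set c := ∫ t in Set.Ioo 0 T, u t * χ t with hc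
  refine ⟨c, ?_⟩
  have key : ∀ᵐ x, x ∈ Set.Ioo 0 T → u x - c = 0 := by
    refine isOpen_Ioo.ae_eq_zero_of_integral_contDiff_smul_eq_zero
      ((hu.sub (integrableOn_const (by simp))).locallyIntegrableOn) fun ψ hψ hψc hψs => ?_
    -- Subtracting `(∫ ψ) χ` makes the integral of `ψ` zero, so the difference is an admissible
    -- derivative; testing with it gives `∫ u ψ = c ∫ ψ`.
    obtain ⟨φ, hφ, hφc, hφs, hφd⟩ := exists_primitive_hasCompactSupport
      (T := T) (η := fun x => ψ x - (∫ y, ψ y) * χ x) (hψ.sub (contDiff_const.mul hχ))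
      (hψc.sub (hχc.mul_left)) (by
        refine (tsupport_sub ψ _).trans (Set.union_subset hψs ?_)
        exact (tsupport_mul_subset_right).trans hχs)
      (by
        rw [integral_sub (hψ.continuous.integrable_of_hasCompactSupport hψc)
          ((hχ.continuous.integrable_of_hasCompactSupport hχc).const_mul _),
          integral_const_mul, hχ1]
        ring)
    have h1 := h φ hφ hφc hφs
    rw [hφd] at h1
    have h2 : ∫ t in Set.Ioo 0 T, u t * (ψ t - (∫ y, ψ y) * χ t) =
        (∫ t in Set.Ioo 0 T, u t * ψ t) - (∫ y, ψ y) * c := by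
      rw [hc, ← integral_const_mul, ← integral_sub (hbd ψ hψ.continuous hψc)
        ((hbd χ hχ.continuous hχc).const_mul _)]
      congr 1; funext t; ring
    rw [h2] at h1
    have h3 : ∫ x, ψ x • (u x - c) = ∫ x in Set.Ioo 0 T, ψ x • (u x - c) := by
      refine (setIntegral_eq_integral_of_forall_compl_eq_zero fun x hx => ?_).symm
      rw [image_eq_zero_of_notMem_tsupport fun h => hx (hψs h), zero_smul]
    have h4 : ∫ x in Set.Ioo 0 T, ψ x = ∫ x, ψ x :=
      setIntegral_eq_integral_of_forall_compl_eq_zero fun x hx =>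
        image_eq_zero_of_notMem_tsupport fun h => hx (hψs h)
    refine h3.trans (Eq.trans ?_ h1)
    rw [← h4, ← integral_mul_const, ← integral_sub (hbd ψ hψ.continuous hψc)
      ((hψ.continuous.integrable_of_hasCompactSupport hψc).integrableOn.mul_const _)]
    congr 1; funext t; simp only [smul_eq_mul]; ring
  refine (ae_restrict_iff' measurableSet_Ioo).2 ?_
  filter_upwards [key] with x hx hx'
  exact sub_eq_zero.1 (hx hx')

/-- Integration by parts for the primitive of an integrable function and a test function. -/
theorem integral_primitive_mul_deriv {T : ℝ} (hT : 0 < T) {w φ : ℝ → ℝ}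
    (hw : IntegrableOn w (Set.Ioo 0 T)) (hφ : ContDiff ℝ ((⊤ : ℕ∞) : WithTop ℕ∞) φ)
    (hs : tsupport φ ⊆ Set.Ioo 0 T) :
    ∫ x in Set.Ioo 0 T, (∫ t in (0)..x, w t) * deriv φ x = - ∫ x in Set.Ioo 0 T, w x * φ x := by
  have hwi : IntervalIntegrable w volume 0 T := by
    rwa [intervalIntegrable_iff_integrableOn_Ioo_of_le hT.le]
  -- Both factors are absolutely continuous, and the boundary terms vanish with `φ`.
  have h := (hwi.absolutelyContinuousOnInterval_intervalIntegral
    (c := 0) Set.left_mem_uIcc).integral_mul_deriv_eq_deriv_mul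
    (g := φ) (ContDiffOn.absolutelyContinuousOnInterval (hφ.of_le (by simp)).contDiffOn)
  have h0 : φ 0 = 0 := image_eq_zero_of_notMem_tsupport fun h => lt_irrefl _ (hs h).1
  have h1 : φ T = 0 := image_eq_zero_of_notMem_tsupport fun h => lt_irrefl _ (hs h).2
  rw [h0, h1, mul_zero, mul_zero, sub_zero, zero_sub, intervalIntegral.integral_of_le hT.le,
    intervalIntegral.integral_of_le hT.le, integral_Ioc_eq_integral_Ioo,
    integral_Ioc_eq_integral_Ioo] at h
  rw [h]
  congr 1
  refine integral_congr_ae ((ae_restrict_iff' measurableSet_Ioo).2 ?_)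
  filter_upwards [hwi.ae_hasDerivAt_integral] with x hx hx'
  rw [Set.uIcc_of_le hT.le] at hx
  rw [(hx (Set.Ioo_subset_Icc_self hx') 0 ⟨le_rfl, hT.le⟩).deriv]

/-- A function with an integrable weak derivative is almost everywhere equal to a primitive of
its weak derivative. -/
theorem HasWeakDeriv.exists_ae_eq_const_add_integral {T : ℝ} (hT : 0 < T) {v w : ℝ → ℝ}
    (hv : IntegrableOn v (Set.Ioo 0 T)) (hw : IntegrableOn w (Set.Ioo 0 T))
    (h : HasWeakDeriv T v w) :
    ∃ c, v =ᵐ[volume.restrict (Set.Ioo 0 T)] fun x => c + ∫ t in (0)..x, w t := by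
  have hwi : IntervalIntegrable w volume 0 T := by
    rwa [intervalIntegrable_iff_integrableOn_Ioo_of_le hT.le]
  have hF : ContinuousOn (fun x => ∫ t in (0)..x, w t) (Set.Icc 0 T) := by
    have := (hwi.absolutelyContinuousOnInterval_intervalIntegral
      (c := 0) Set.left_mem_uIcc).continuousOn
    rwa [Set.uIcc_of_le hT.le] at this
  have hFi : IntegrableOn (fun x => ∫ t in (0)..x, w t) (Set.Ioo 0 T) :=
    hF.integrableOn_Icc.mono_set Set.Ioo_subset_Icc_self
  -- The function minus the primitive of `w` has weak derivative zero.
  obtain ⟨c, hc⟩ := ae_eq_const_of_integral_mul_deriv_eq_zero hT (hv.sub hFi)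
    fun φ hφ hφc hφs => by
      have hbd : ∀ u, IntegrableOn u (Set.Ioo 0 T) →
          IntegrableOn (fun t => u t * deriv φ t) (Set.Ioo 0 T) := by
        intro u hu
        obtain ⟨K, hK⟩ := (hφ.continuous_deriv (by simp)).bounded_above_of_compact_support hφc.deriv
        exact hu.mul_bdd (hφ.continuous_deriv (by simp)).aestronglyMeasurable
          (Eventually.of_forall hK)
      have h1 := h.2.2 φ hφ hφc hφs
      have h2 := integral_primitive_mul_deriv hT hw hφ hφs
      simp only [Pi.sub_apply, sub_mul]
      rw [integral_sub (hbd _ hv) (hbd _ hFi), h1, h2, sub_self]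
  refine ⟨c, ?_⟩
  filter_upwards [hc] with x hx
  simp only [Pi.sub_apply] at hx
  linarith

/-! ### The interpolation error on one cell -/

/-- On an interval, the double integral of `|w t - w s|` is bounded by the Slobodeckij seminorm. -/
theorem lintegral_abs_sub_le_seminorm {a b p σ : ℝ} (hab : a < b) (hp : 1 ≤ p) (hσ : 0 < σ)
    {w : ℝ → ℝ} (hw : AEStronglyMeasurable w (volume.restrict (Set.Ioc a b))) :
    ∫⁻ s in Set.Ioc a b, ∫⁻ t in Set.Ioc a b, ENNReal.ofReal |w t - w s| ≤
      ENNReal.ofReal ((b - a) ^ (2 + σ - 1 / p)) *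
        (∫⁻ s in Set.Ioc a b, ∫⁻ t in Set.Ioc a b,
          ENNReal.ofReal (|w t - w s| ^ p / |t - s| ^ (1 + σ * p))) ^ (1 / p) := by
  set μ := volume.restrict (Set.Ioc a b) with hμ
  have hp0 : 0 < p := by linarith
  have hh : 0 < b - a := sub_pos.2 hab
  have hF : AEStronglyMeasurable (fun q : ℝ × ℝ => w q.2 - w q.1) (μ.prod μ) :=
    hw.comp_snd.sub hw.comp_fst
  have hFm := hF.aemeasurable
  have e1 : ∫⁻ s, ∫⁻ t, ENNReal.ofReal |w t - w s| ∂μ ∂μ =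
      eLpNorm (fun q : ℝ × ℝ => w q.2 - w q.1) 1 (μ.prod μ) := by
    rw [eLpNorm_one_eq_lintegral_enorm, lintegral_prod _ hFm.enorm]
    simp_rw [Real.enorm_eq_ofReal_abs]
  have e2 : eLpNorm (fun q : ℝ × ℝ => w q.2 - w q.1) (ENNReal.ofReal p) (μ.prod μ) =
      (∫⁻ s, ∫⁻ t, ENNReal.ofReal (|w t - w s| ^ p) ∂μ ∂μ) ^ (1 / p) := by
    rw [eLpNorm_eq_lintegral_rpow_enorm_toReal (by simpa using hp0) ENNReal.ofReal_ne_top,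
      ENNReal.toReal_ofReal hp0.le, lintegral_prod _ (hFm.enorm.pow_const p)]
    simp_rw [Real.enorm_eq_ofReal_abs, ENNReal.ofReal_rpow_of_nonneg (abs_nonneg _) hp0.le]
  have e3 : ∫⁻ s, ∫⁻ t, ENNReal.ofReal (|w t - w s| ^ p) ∂μ ∂μ ≤
      ENNReal.ofReal ((b - a) ^ (1 + σ * p)) * ∫⁻ s, ∫⁻ t,
          ENNReal.ofReal (|w t - w s| ^ p / |t - s| ^ (1 + σ * p)) ∂μ ∂μ := by
    rw [← lintegral_const_mul' _ _ ENNReal.ofReal_ne_top]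
    refine setLIntegral_mono' measurableSet_Ioc fun s hs => ?_
    rw [← lintegral_const_mul' _ _ ENNReal.ofReal_ne_top]
    refine setLIntegral_mono' measurableSet_Ioc fun t ht => ?_
    rw [← ENNReal.ofReal_mul (by positivity)]
    refine ENNReal.ofReal_le_ofReal ?_
    rcases eq_or_ne t s with rfl | hts
    · simp [Real.zero_rpow hp0.ne']
    have h0 : 0 < |t - s| := abs_pos.2 (sub_ne_zero.2 hts)
    have h1 : |t - s| ≤ b - a := by
      rw [abs_le]; constructor <;> linarith [hs.1, hs.2, ht.1, ht.2]
    have h2 : |t - s| ^ (1 + σ * p) ≤ (b - a) ^ (1 + σ * p) :=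
      Real.rpow_le_rpow h0.le h1 (by positivity)
    rw [← mul_div_assoc, le_div_iff₀ (by positivity), mul_comm]
    exact mul_le_mul_of_nonneg_right h2 (by positivity)
  -- Hölder on a square of area `(b - a)²`; the final exponent is `(1 + σp)/p + 2(1 - 1/p) = 2 + σ -
  -- 1/p`.
  have h := eLpNorm_le_eLpNorm_mul_rpow_measure_univ (μ := μ.prod μ) (p := 1)
    (q := ENNReal.ofReal p) (by simpa using hp) hF
  rw [← e1, e2, ENNReal.toReal_one, ENNReal.toReal_ofReal hp0.le, one_div_one] at h
  have hu : (μ.prod μ) Set.univ = ENNReal.ofReal ((b - a) * (b - a)) := by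
    rw [← Set.univ_prod_univ, Measure.prod_prod, hμ, Measure.restrict_apply_univ, Real.volume_Ioc,
      ENNReal.ofReal_mul hh.le]
  rw [hu] at h
  refine h.trans ?_
  calc _ ≤ (ENNReal.ofReal ((b - a) ^ (1 + σ * p)) * ∫⁻ s, ∫⁻ t,
          ENNReal.ofReal (|w t - w s| ^ p / |t - s| ^ (1 + σ * p)) ∂μ ∂μ) ^ (1 / p) *
          ENNReal.ofReal ((b - a) * (b - a)) ^ (1 - 1 / p) := by gcongr
    _ = _ := by
      have hq : 0 ≤ 1 - 1 / p := by
        rw [sub_nonneg, div_le_one hp0]; exact hp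
      rw [ENNReal.mul_rpow_of_nonneg _ _ (by positivity), mul_right_comm,
        ENNReal.ofReal_rpow_of_nonneg (by positivity) (by positivity),
        ENNReal.ofReal_rpow_of_nonneg (by positivity) hq, ← ENNReal.ofReal_mul (by positivity)]
      congr 2
      rw [← Real.rpow_mul hh.le, Real.mul_rpow hh.le hh.le, ← Real.rpow_add hh,
        ← Real.rpow_add hh]
      congr 1
      field_simp
      ring

/-- The `L¹` distance of an integrable function to its mean is at most the mean oscillation. -/
theorem lintegral_abs_sub_average_le {a b : ℝ} (hab : a < b) {w : ℝ → ℝ}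
    (hw : IntegrableOn w (Set.Ioc a b)) :
    ∫⁻ t in Set.Ioc a b, ENNReal.ofReal |w t - (∫ s in a..b, w s) / (b - a)| ≤
      ENNReal.ofReal (1 / (b - a)) *
        ∫⁻ s in Set.Ioc a b, ∫⁻ t in Set.Ioc a b, ENNReal.ofReal |w t - w s| := by
  have hh : 0 < b - a := sub_pos.2 hab
  rw [← lintegral_const_mul' _ _ ENNReal.ofReal_ne_top]
  refine lintegral_mono fun t => ?_
  have h1 : w t - (∫ s in a..b, w s) / (b - a) = (1 / (b - a)) * ∫ s in Set.Ioc a b, (w t - w s) := by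
    rw [integral_sub (integrable_const _) hw, setIntegral_const,
      intervalIntegral.integral_of_le hab.le, measureReal_def, Real.volume_Ioc,
      ENNReal.toReal_ofReal hh.le, smul_eq_mul]
    field_simp
  rw [h1, abs_mul, abs_of_pos (by positivity), ENNReal.ofReal_mul (by positivity)]
  gcongr
  refine (ofReal_norm (∫ s in Set.Ioc a b, (w t - w s))).le.trans
    ((enorm_integral_le_lintegral_enorm _).trans (le_of_eq ?_))
  refine lintegral_congr fun s => ?_
  rw [Real.enorm_eq_ofReal_abs, abs_sub_comm]

/-- The error of the interpolation `½ (f(a + θh) + f(b - θh)) + (f(b) - f(a)) (t - (a + b)/2) / h`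
on a cell `[a, b]` of length `h`. -/
theorem abs_sub_interpolation_le {a b p σ θ : ℝ} (hab : a < b) (hp : 1 ≤ p) (hσ : 0 < σ)
    (hθ : θ ∈ Set.Icc (0 : ℝ) 1) {f w : ℝ → ℝ} (hw : IntegrableOn w (Set.Ioc a b))
    (hf : ∀ s ∈ Set.Icc a b, ∀ t ∈ Set.Icc a b, f t - f s = ∫ x in s..t, w x)
    {t : ℝ} (ht : t ∈ Set.Icc a b) :
    ENNReal.ofReal |f t - (1 / 2 * (f (a + θ * (b - a)) + f (a + (1 - θ) * (b - a))) +
        1 / (b - a) * (f b - f a) * (t - (a + b) / 2))| ≤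
      ENNReal.ofReal ((b - a) ^ (1 + σ - 1 / p)) *
        (∫⁻ s in Set.Ioc a b, ∫⁻ t in Set.Ioc a b,
          ENNReal.ofReal (|w t - w s| ^ p / |t - s| ^ (1 + σ * p))) ^ (1 / p) := by
  have hh : 0 < b - a := sub_pos.2 hab
  -- The mean of `w` is the slope of the chord of `f`, so `f t - f s - m (t - s)` is an integral of
  -- `w - m`.
  set m := (∫ s in a..b, w s) / (b - a) with hm
  have hmf : 1 / (b - a) * (f b - f a) = m := by
    rw [hf a ⟨le_rfl, hab.le⟩ b ⟨hab.le, le_rfl⟩, hm]; ring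
  have hi : IntegrableOn (fun x => |w x - m|) (Set.Ioc a b) :=
    (hw.sub (integrableOn_const (by simp))).abs
  set A := ∫ x in Set.Ioc a b, |w x - m| with hA
  have hosc' : ∀ s ∈ Set.Icc a b, ∀ t ∈ Set.Icc a b, s ≤ t →
      |f t - f s - m * (t - s)| ≤ A := by
    intro s hs t ht hst
    have hsub : Set.Ioc s t ⊆ Set.Ioc a b := Set.Ioc_subset_Ioc hs.1 ht.2
    have h1 : f t - f s - m * (t - s) = ∫ x in s..t, (w x - m) := by
      rw [intervalIntegral.integral_sub _ intervalIntegrable_const, hf s hs t ht,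
        intervalIntegral.integral_const, smul_eq_mul, mul_comm]
      exact (intervalIntegrable_iff_integrableOn_Ioc_of_le hst).2 (hw.mono_set hsub)
    rw [h1, intervalIntegral.integral_of_le hst]
    exact abs_integral_le_integral_abs.trans
      (setIntegral_mono_set hi (Eventually.of_forall fun _ => abs_nonneg _) hsub.eventuallyLE)
  have hosc : ∀ s ∈ Set.Icc a b, ∀ t ∈ Set.Icc a b, |f t - f s - m * (t - s)| ≤ A := by
    intro s hs t ht
    rcases le_total s t with hst | hst
    · exact hosc' s hs t ht hst
    · rw [← abs_neg]
      convert hosc' t ht s hs hst using 2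
      ring
  have hl : a + θ * (b - a) ∈ Set.Icc a b := by
    constructor <;> nlinarith [hθ.1, hθ.2]
  have hr : a + (1 - θ) * (b - a) ∈ Set.Icc a b := by
    constructor <;> nlinarith [hθ.1, hθ.2]
  have hle : |f t - (1 / 2 * (f (a + θ * (b - a)) + f (a + (1 - θ) * (b - a))) +
        1 / (b - a) * (f b - f a) * (t - (a + b) / 2))| ≤ A := by
    rw [hmf]
    -- The nodes average to `(a + b) / 2`, so the error is the mean of the two deviations from `t`
    -- to the nodes.
    have h1 := hosc _ hl t ht
    have h2 := hosc _ hr t ht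
    rw [abs_le] at h1 h2 ⊢
    constructor <;> linarith [h1.1, h1.2, h2.1, h2.2]
  refine (ENNReal.ofReal_le_ofReal hle).trans ?_
  rw [hA, ofReal_integral_eq_lintegral_ofReal hi (Eventually.of_forall fun _ => abs_nonneg _)]
  refine (lintegral_abs_sub_average_le hab hw).trans ?_
  refine (mul_le_mul_right (lintegral_abs_sub_le_seminorm hab hp hσ hw.aestronglyMeasurable) _).trans
    (le_of_eq ?_)
  rw [← mul_assoc, ← ENNReal.ofReal_mul (by positivity)]
  congr 2
  rw [one_div, ← Real.rpow_neg_one, ← Real.rpow_add hh]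
  congr 1
  ring

/-! ### Summation over the cells -/

theorem gridPoint_zero (T : ℝ) (N : ℕ) : gridPoint T N 0 = 0 := by simp [gridPoint]

theorem gridPoint_self (T : ℝ) {N : ℕ} (hN : 0 < N) : gridPoint T N N = T := by
  have : (N : ℝ) ≠ 0 := by positivity
  rw [gridPoint]; field_simp

theorem gridPoint_succ_sub (T : ℝ) (N j : ℕ) :
    gridPoint T N (j + 1) - gridPoint T N j = T / N := by
  simp only [gridPoint]; push_cast; ring

theorem gridPoint_mono {T : ℝ} (hT : 0 ≤ T) (N : ℕ) : Monotone (gridPoint T N) := by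
  intro i j hij
  have : (i : ℝ) ≤ j := by exact_mod_cast hij
  exact mul_le_mul_of_nonneg_right this (by positivity)

theorem gridPoint_lt_succ {T : ℝ} (hT : 0 < T) {N : ℕ} (hN : 0 < N) (j : ℕ) :
    gridPoint T N j < gridPoint T N (j + 1) := by
  rw [← sub_pos, gridPoint_succ_sub]; positivity

theorem gridPoint_nonneg {T : ℝ} (hT : 0 ≤ T) (N j : ℕ) : 0 ≤ gridPoint T N j :=
  mul_nonneg (by positivity) (by positivity)

theorem gridPoint_le {T : ℝ} (hT : 0 ≤ T) {N j : ℕ} (hN : 0 < N) (hj : j ≤ N) :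
    gridPoint T N j ≤ T := by
  have := gridPoint_mono hT N hj
  rwa [gridPoint_self T hN] at this

/-- The squares over the diagonal cells are part of the square over the whole interval. -/
theorem sum_lintegral_cell_le {T : ℝ} (hT : 0 < T) {N : ℕ} (hN : 0 < N) (F : ℝ → ℝ → ENNReal) :
    ∑ j ∈ Finset.range N, ∫⁻ s in Set.Ioc (gridPoint T N j) (gridPoint T N (j + 1)),
        ∫⁻ t in Set.Ioc (gridPoint T N j) (gridPoint T N (j + 1)), F s t ≤
      ∫⁻ s in Set.Ioo 0 T, ∫⁻ t in Set.Ioo 0 T, F s t := by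
  -- Only the outer integral is split exactly; the inner one is enlarged to the whole interval.
  have h1 : ∀ m ≤ N, ∑ j ∈ Finset.range m,
      ∫⁻ s in Set.Ioc (gridPoint T N j) (gridPoint T N (j + 1)), ∫⁻ t in Set.Ioc 0 T, F s t =
      ∫⁻ s in Set.Ioc 0 (gridPoint T N m), ∫⁻ t in Set.Ioc 0 T, F s t := by
    intro m hm
    induction m with
    | zero => simp [gridPoint_zero]
    | succ m ih =>
      rw [Finset.sum_range_succ, ih (by omega),
        ← lintegral_union measurableSet_Ioc
          (Set.disjoint_left.2 fun x hx hx' => absurd hx.2 (not_le.2 hx'.1)),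
        Set.Ioc_union_Ioc_eq_Ioc (gridPoint_nonneg hT.le _ _) (gridPoint_lt_succ hT hN m).le]
  have h2 := h1 N le_rfl
  rw [gridPoint_self T hN] at h2
  simp_rw [restrict_Ioo_eq_restrict_Ioc]
  rw [← h2]
  refine Finset.sum_le_sum fun j hj => lintegral_mono fun s => lintegral_mono_set ?_
  exact Set.Ioc_subset_Ioc (gridPoint_nonneg hT.le _ _)
    (gridPoint_le hT.le hN (Finset.mem_range.1 hj))

/-- The power mean inequality with exponent `p / 2 ≥ 1` gives `∑ e_j^{2/p} ≤ N^{1-2/p} A^{2/p}`.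
With `h = T / N`, the factor `h^{3+2σ-2/p} N^{1-2/p}` equals `h^{2+2σ} T^{1-2/p}`. -/
theorem sum_mul_sq_rpow_le {T p σ A : ℝ} (hT : 0 < T) (hp : 2 ≤ p) {N : ℕ} (hN : 0 < N)
    {e : ℕ → ℝ} (he : ∀ j, 0 ≤ e j) (hA : ∑ j ∈ Finset.range N, e j ≤ A) :
    ∑ j ∈ Finset.range N, T / N * ((T / N) ^ (1 + σ - 1 / p) * e j ^ (1 / p)) ^ 2 ≤
      ((T / N) ^ (1 + σ) * T ^ ((p - 2) / (2 * p)) * A ^ (1 / p)) ^ 2 := by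
  have hp0 : 0 < p := by linarith
  have hN0 : (0 : ℝ) < N := by positivity
  set h := T / N with hh
  have hh0 : 0 < h := by positivity
  have hTN : T = N * h := by rw [hh]; field_simp
  have hA0 : 0 ≤ A := (Finset.sum_nonneg fun j _ => he j).trans hA
  have h1 := Real.rpow_sum_le_const_mul_sum_rpow (Finset.range N) (fun j => e j ^ (2 / p))
    (p := p / 2) (by linarith)
  have h2 : ∑ j ∈ Finset.range N, |e j ^ (2 / p)| ^ (p / 2) = ∑ j ∈ Finset.range N, e j := by
    refine Finset.sum_congr rfl fun j _ => ?_
    rw [abs_of_nonneg (Real.rpow_nonneg (he j) _), ← Real.rpow_mul (he j),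
      show 2 / p * (p / 2) = 1 by field_simp, Real.rpow_one]
  have h3 : ∑ j ∈ Finset.range N, |e j ^ (2 / p)| = ∑ j ∈ Finset.range N, e j ^ (2 / p) :=
    Finset.sum_congr rfl fun j _ => abs_of_nonneg (Real.rpow_nonneg (he j) _)
  rw [h2, h3, Finset.card_range] at h1
  have hS : 0 ≤ ∑ j ∈ Finset.range N, e j ^ (2 / p) :=
    Finset.sum_nonneg fun j _ => Real.rpow_nonneg (he j) _
  have h4 : ∑ j ∈ Finset.range N, e j ^ (2 / p) ≤ (N : ℝ) ^ (1 - 2 / p) * A ^ (2 / p) := by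
    have h5 : (∑ j ∈ Finset.range N, e j ^ (2 / p)) ^ (p / 2) ≤ (N : ℝ) ^ (p / 2 - 1) * A :=
      h1.trans (mul_le_mul_of_nonneg_left hA (by positivity))
    have h6 := Real.rpow_le_rpow (by positivity) h5 (show (0 : ℝ) ≤ 2 / p by positivity)
    rw [← Real.rpow_mul hS, show p / 2 * (2 / p) = 1 by field_simp, Real.rpow_one,
      Real.mul_rpow (by positivity) hA0, ← Real.rpow_mul hN0.le] at h6
    convert h6 using 3
    field_simp
  have h7 : ∀ j, h * (h ^ (1 + σ - 1 / p) * e j ^ (1 / p)) ^ 2 =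
      h ^ (3 + 2 * σ - 2 / p) * e j ^ (2 / p) := by
    intro j
    rw [mul_pow, ← Real.rpow_natCast (e j ^ (1 / p)), ← Real.rpow_mul (he j),
      ← Real.rpow_natCast (h ^ _), ← Real.rpow_mul hh0.le, ← mul_assoc]
    nth_rw 1 [← Real.rpow_one h]
    rw [← Real.rpow_add hh0]
    congr 2
    · push_cast; ring
    · push_cast; ring
  simp_rw [h7]
  rw [← Finset.mul_sum]
  refine (mul_le_mul_of_nonneg_left h4 (by positivity)).trans (le_of_eq ?_)
  rw [mul_pow, mul_pow, ← Real.rpow_natCast (A ^ _), ← Real.rpow_mul hA0,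
    ← Real.rpow_natCast (h ^ _), ← Real.rpow_mul hh0.le, ← Real.rpow_natCast (T ^ _),
    ← Real.rpow_mul hT.le, ← mul_assoc]
  rw [hTN, Real.mul_rpow hN0.le hh0.le, mul_left_comm, ← Real.rpow_add hh0,
    mul_comm ((N : ℝ) ^ _)]
  congr 2
  · congr 1
    push_cast; field_simp; ring
  · congr 1
    push_cast; field_simp
  · push_cast; ring

/-! ### The Itô isometry for simple processes -/

section Increments

variable {Ω : Type*} {mΩ : MeasurableSpace Ω} {P : Measure Ω} {T : ℝ} {𝓕 : Filtration ℝ mΩ}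
  {W : ℝ → Ω → ℝ}

theorem IsWienerProcessOn.measurable_increment (hW : IsWienerProcessOn T 𝓕 W P) {s t : ℝ}
    (hs : 0 ≤ s) (hst : s ≤ t) (ht : t ≤ T) : Measurable[𝓕 t] (fun ω => W t ω - W s ω) :=
  Measurable.sub (hW.adapted t ⟨hs.trans hst, ht⟩)
    ((hW.adapted s ⟨hs, hst.trans ht⟩).mono (𝓕.mono hst) le_rfl)

theorem IsWienerProcessOn.memLp_increment (hW : IsWienerProcessOn T 𝓕 W P) {s t : ℝ}
    (hs : 0 ≤ s) (hst : s ≤ t) (ht : t ≤ T) : MemLp (fun ω => W t ω - W s ω) 2 P := by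
  have hl := hW.gaussian_increments s t hs hst ht
  have h := memLp_id_gaussianReal (μ := 0) (v := (t - s).toNNReal) 2
  rw [← hl.map_eq] at h
  exact h.comp_of_map hl.aemeasurable

theorem IsWienerProcessOn.integral_increment (hW : IsWienerProcessOn T 𝓕 W P) {s t : ℝ}
    (hs : 0 ≤ s) (hst : s ≤ t) (ht : t ≤ T) : ∫ ω, (W t ω - W s ω) ∂P = 0 := by
  rw [(hW.gaussian_increments s t hs hst ht).integral_eq, integral_id_gaussianReal]

theorem IsWienerProcessOn.integral_increment_sq (hW : IsWienerProcessOn T 𝓕 W P) {s t : ℝ}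
    (hs : 0 ≤ s) (hst : s ≤ t) (ht : t ≤ T) : ∫ ω, (W t ω - W s ω) ^ 2 ∂P = t - s := by
  have hl := hW.gaussian_increments s t hs hst ht
  have h := hl.variance_eq
  rw [variance_id_gaussianReal, variance_eq_integral hl.aemeasurable,
    hW.integral_increment hs hst ht, Real.coe_toNNReal _ (sub_nonneg.2 hst)] at h
  simpa using h

theorem IsWienerProcessOn.indepFun_increment (hW : IsWienerProcessOn T 𝓕 W P) {s t : ℝ}
    (hs : 0 ≤ s) (hst : s ≤ t) (ht : t ≤ T) {Z : Ω → ℝ} (hZ : Measurable[𝓕 s] Z) :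
    IndepFun Z (fun ω => W t ω - W s ω) P := by
  rw [IndepFun_iff_Indep]
  exact indep_of_indep_of_le_left (hW.indep_increments s t hs hst ht).symm hZ.comap_le

theorem IsWienerProcessOn.integral_mul_increment (hW : IsWienerProcessOn T 𝓕 W P) {s t : ℝ}
    (hs : 0 ≤ s) (hst : s ≤ t) (ht : t ≤ T) {Z : Ω → ℝ} (hZ : Measurable[𝓕 s] Z) :
    ∫ ω, Z ω * (W t ω - W s ω) ∂P = 0 := by
  rw [(hW.indepFun_increment hs hst ht hZ).integral_fun_mul_eq_mul_integral
    (hZ.mono (𝓕.le s) le_rfl).aestronglyMeasurable (hW.memLp_increment hs hst ht).1,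
    hW.integral_increment hs hst ht, mul_zero]

theorem IsWienerProcessOn.integral_mul_increment_sq (hW : IsWienerProcessOn T 𝓕 W P) {s t : ℝ}
    (hs : 0 ≤ s) (hst : s ≤ t) (ht : t ≤ T) {Z : Ω → ℝ} (hZ : Measurable[𝓕 s] Z) :
    ∫ ω, Z ω * (W t ω - W s ω) ^ 2 ∂P = (∫ ω, Z ω ∂P) * (t - s) := by
  have h := (hW.indepFun_increment hs hst ht hZ).comp measurable_id (measurable_id.pow_const 2)
  have h2 := h.integral_fun_mul_eq_mul_integral
    (hZ.mono (𝓕.le s) le_rfl).aestronglyMeasurable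
    ((hW.memLp_increment hs hst ht).1.aemeasurable.pow_const 2).aestronglyMeasurable
  simp only [Function.comp_def, id_eq] at h2
  rw [h2, hW.integral_increment_sq hs hst ht]

theorem IsWienerProcessOn.integrable_mul_increment_mul_increment
    (hW : IsWienerProcessOn T 𝓕 W P) {a b c d : ℝ} (ha : 0 ≤ a) (hab : a ≤ b) (hb : b ≤ T)
    (hc : 0 ≤ c) (hcd : c ≤ d) (hd : d ≤ T) {Z : Ω → ℝ} (hZ : AEStronglyMeasurable Z P)
    {K : ℝ} (hK : ∀ ω, |Z ω| ≤ K) :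
    Integrable (fun ω => Z ω * ((W b ω - W a ω) * (W d ω - W c ω))) P :=
  ((hW.memLp_increment ha hab hb).integrable_mul (hW.memLp_increment hc hcd hd)).bdd_mul hZ
    (Eventually.of_forall hK)

/-- Both increments are split at `c` and at `min b d`. In every mixed product one factor is an
increment independent of all the rest and has mean zero; only the square over the common interval
survives and contributes its length. If `b ≤ c`, nothing survives. -/
theorem IsWienerProcessOn.integral_mul_increments_of_le (hW : IsWienerProcessOn T 𝓕 W P)
    {a b c d : ℝ} (ha : 0 ≤ a) (hab : a ≤ b) (hb : b ≤ T) (hcd : c ≤ d) (hd : d ≤ T)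
    (hac : a ≤ c) {Z : Ω → ℝ} (hZ : Measurable[𝓕 c] Z) {K : ℝ} (hK : ∀ ω, |Z ω| ≤ K) :
    ∫ ω, Z ω * ((W b ω - W a ω) * (W d ω - W c ω)) ∂P =
      (∫ ω, Z ω ∂P) * max 0 (min b d - max a c) := by
  have hc := ha.trans hac
  have hZm := (hZ.mono (𝓕.le c) le_rfl).aestronglyMeasurable (μ := P)
  rw [max_eq_right hac]
  rcases le_total b c with hbc | hcb
  · have h := hW.integral_mul_increment hc hcd hd (Z := fun ω => Z ω * (W b ω - W a ω))
      (hZ.mul ((hW.measurable_increment ha hab hb).mono (𝓕.mono hbc) le_rfl))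
    rw [max_eq_left (by linarith [min_le_left b d]), mul_zero, ← h]
    congr 1; funext ω; ring
  have hcT := hcd.trans hd
  have h1 := hW.integral_mul_increment hc hcd hd (Z := fun ω => Z ω * (W c ω - W a ω))
      (hZ.mul (hW.measurable_increment ha hac hcT))
  have i1 := hW.integrable_mul_increment_mul_increment ha hac hcT hc hcd hd hZm hK
  rw [max_eq_right (by rw [sub_nonneg]; exact le_min hcb hcd)]
  rcases le_total b d with hbd | hdb
  · have h2 := hW.integral_mul_increment_sq hc hcb hb hZ
    have h3 := hW.integral_mul_increment (hc.trans hcb) hbd hd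
      (Z := fun ω => Z ω * (W b ω - W c ω))
      ((hZ.mono (𝓕.mono hcb) le_rfl).mul (hW.measurable_increment hc hcb hb))
    have i2 := hW.integrable_mul_increment_mul_increment hc hcb hb hc hcb hb hZm hK
    have i3 := hW.integrable_mul_increment_mul_increment hc hcb hb (hc.trans hcb) hbd hd hZm hK
    have i12 : Integrable (fun ω => Z ω * ((W c ω - W a ω) * (W d ω - W c ω)) +
      Z ω * ((W b ω - W c ω) * (W b ω - W c ω))) P := i1.add i2
    have e : ∀ ω, Z ω * ((W b ω - W a ω) * (W d ω - W c ω)) =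
        Z ω * ((W c ω - W a ω) * (W d ω - W c ω)) + Z ω * ((W b ω - W c ω) * (W b ω - W c ω)) +
        Z ω * ((W b ω - W c ω) * (W d ω - W b ω)) := fun ω => by ring
    simp_rw [e]
    rw [integral_add i12 i3, integral_add i1 i2]
    simp_rw [← mul_assoc]
    rw [h1, h3, min_eq_left hbd, ← h2]
    simp [mul_assoc, pow_two]
  · have h2 := hW.integral_mul_increment_sq hc hcd hd hZ
    have h3 := hW.integral_mul_increment (hc.trans hcd) hdb hb
      (Z := fun ω => Z ω * (W d ω - W c ω))
      ((hZ.mono (𝓕.mono hcd) le_rfl).mul (hW.measurable_increment hc hcd hd))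
    have i2 := hW.integrable_mul_increment_mul_increment hc hcd hd hc hcd hd hZm hK
    have i3 := hW.integrable_mul_increment_mul_increment hc hcd hd (hc.trans hcd) hdb hb hZm hK
    have i12 : Integrable (fun ω => Z ω * ((W c ω - W a ω) * (W d ω - W c ω)) +
      Z ω * ((W d ω - W c ω) * (W d ω - W c ω))) P := i1.add i2
    have e : ∀ ω, Z ω * ((W b ω - W a ω) * (W d ω - W c ω)) =
        Z ω * ((W c ω - W a ω) * (W d ω - W c ω)) + Z ω * ((W d ω - W c ω) * (W d ω - W c ω)) +
        Z ω * ((W d ω - W c ω) * (W b ω - W d ω)) := fun ω => by ring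
    simp_rw [e]
    rw [integral_add i12 i3, integral_add i1 i2]
    simp_rw [← mul_assoc]
    rw [h1, h3, min_eq_right hdb, ← h2]
    simp [mul_assoc, pow_two]

theorem IsWienerProcessOn.integral_mul_increments (hW : IsWienerProcessOn T 𝓕 W P)
    {a b c d : ℝ} (ha : 0 ≤ a) (hab : a ≤ b) (hb : b ≤ T) (hc : 0 ≤ c) (hcd : c ≤ d) (hd : d ≤ T)
    {ξ η : Ω → ℝ} (hξ : Measurable[𝓕 a] ξ) (hη : Measurable[𝓕 c] η)
    (hξb : ∃ K, ∀ ω, |ξ ω| ≤ K) (hηb : ∃ K, ∀ ω, |η ω| ≤ K) :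
    ∫ ω, (ξ ω * (W b ω - W a ω)) * (η ω * (W d ω - W c ω)) ∂P =
      (∫ ω, ξ ω * η ω ∂P) * max 0 (min b d - max a c) := by
  obtain ⟨K, hK⟩ := hξb
  obtain ⟨L, hL⟩ := hηb
  have hKL : ∀ ω, |ξ ω * η ω| ≤ K * L := fun ω => by
    rw [abs_mul]
    exact mul_le_mul (hK ω) (hL ω) (abs_nonneg _) ((abs_nonneg _).trans (hK ω))
  rcases le_total a c with hac | hca
  · rw [← hW.integral_mul_increments_of_le ha hab hb hcd hd hac
      (Z := fun ω => ξ ω * η ω) ((hξ.mono (𝓕.mono hac) le_rfl).mul hη) hKL]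
    congr 1; funext ω; ring
  · rw [min_comm, max_comm a c, ← hW.integral_mul_increments_of_le hc hcd hd hab hb hca
      (Z := fun ω => ξ ω * η ω) (hξ.mul (hη.mono (𝓕.mono hca) le_rfl)) hKL]
    congr 1; funext ω; ring

end Increments

/-! ### Second moments of elementary integrals with possibly overlapping intervals -/

section Isometry

variable {Ω : Type*} {mΩ : MeasurableSpace Ω} {P : Measure Ω} [IsProbabilityMeasure P] {T : ℝ}
  {𝓕 : Filtration ℝ mΩ} {W : ℝ → Ω → ℝ} {a b : ℝ}

theorem integral_indicator_Ioc_mul_indicator_Ioc {a b l r l' r' : ℝ} (hl : a ≤ l) (hr : r ≤ b) :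
    ∫ t in Set.Ioc a b, (Set.Ioc l r).indicator (fun _ => (1 : ℝ)) t *
        (Set.Ioc l' r').indicator (fun _ => (1 : ℝ)) t = max 0 (min r r' - max l l') := by
  simp_rw [← Set.inter_indicator_mul, Set.Ioc_inter_Ioc, mul_one]
  rw [setIntegral_indicator measurableSet_Ioc,
    Set.inter_eq_right.2 (Set.Ioc_subset_Ioc (hl.trans le_sup_left) (inf_le_left.trans hr)),
    setIntegral_const, smul_eq_mul, mul_one, measureReal_def, Real.volume_Ioc,
    ENNReal.toReal_ofReal', max_comm]

theorem SimpleProcess.val_eq_sum (S : SimpleProcess 𝓕 a b) (t : ℝ) (ω : Ω) :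
    S.val t ω = ∑ i, (Set.Ioc (S.l i) (S.r i)).indicator (fun _ => (1 : ℝ)) t * S.ξ i ω := by
  refine Finset.sum_congr rfl fun i _ => ?_
  by_cases h : t ∈ Set.Ioc (S.l i) (S.r i) <;> simp [h]

theorem SimpleProcess.measurable_coeff (S : SimpleProcess 𝓕 a b) (i : Fin S.n) :
    Measurable (S.ξ i) :=
  (S.measurable_ξ i).mono (𝓕.le _) le_rfl

theorem SimpleProcess.memLp_term (S : SimpleProcess 𝓕 a b) (i : Fin S.n) (q : ENNReal) :
    MemLp (fun x : ℝ × Ω => (Set.Ioc (S.l i) (S.r i)).indicator (fun _ => (1 : ℝ)) x.1 *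
      S.ξ i x.2) q ((volume.restrict (Set.Ioc a b)).prod P) := by
  obtain ⟨K, hK⟩ := S.bounded_ξ i
  refine MemLp.of_bound (C := K) ?_ (Eventually.of_forall fun x => ?_)
  · exact (((measurable_const.indicator measurableSet_Ioc).comp measurable_fst).mul
      ((S.measurable_coeff i).comp measurable_snd)).aestronglyMeasurable
  · rw [Real.norm_eq_abs, abs_mul]
    by_cases h : x.1 ∈ Set.Ioc (S.l i) (S.r i)
    · simpa [h] using hK x.2
    · simpa [h] using (abs_nonneg _).trans (hK x.2)

theorem SimpleProcess.memLp_val (S : SimpleProcess 𝓕 a b) (q : ENNReal) :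
    MemLp (fun x : ℝ × Ω => S.val x.1 x.2) q ((volume.restrict (Set.Ioc a b)).prod P) := by
  simp_rw [S.val_eq_sum]
  exact memLp_finsetSum _ fun i _ => S.memLp_term i q

theorem SimpleProcess.memLp_integral_term (S : SimpleProcess 𝓕 a b)
    (hW : IsWienerProcessOn T 𝓕 W P) (ha : 0 ≤ a) (hb : b ≤ T) (i : Fin S.n) :
    MemLp (fun ω => S.ξ i ω * (W (S.r i) ω - W (S.l i) ω)) 2 P := by
  obtain ⟨K, hK⟩ := S.bounded_ξ i
  have h := hW.memLp_increment (ha.trans (S.a_le i)) (S.l_le_r i) ((S.r_le i).trans hb)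
  exact h.mul (MemLp.of_bound (p := ⊤) (S.measurable_coeff i).aestronglyMeasurable K
    (Eventually.of_forall hK))

theorem SimpleProcess.memLp_integral (S : SimpleProcess 𝓕 a b)
    (hW : IsWienerProcessOn T 𝓕 W P) (ha : 0 ≤ a) (hb : b ≤ T) : MemLp (S.integral W) 2 P :=
  memLp_finsetSum _ fun i _ => S.memLp_integral_term hW ha hb i

/-- Both squares expand into double sums, and the `(i, j)` terms agree one by one: each is the
expectation of `ξ i * ξ j` times the length of the overlap of the two intervals. Disjointness plays
no role. -/
theorem SimpleProcess.integral_integral_sq (S : SimpleProcess 𝓕 a b)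
    (hW : IsWienerProcessOn T 𝓕 W P) (ha : 0 ≤ a) (hb : b ≤ T) :
    ∫ ω, S.integral W ω ^ 2 ∂P =
      ∫ x, S.val x.1 x.2 ^ 2 ∂((volume.restrict (Set.Ioc a b)).prod P) := by
  simp_rw [S.val_eq_sum, SimpleProcess.integral, pow_two, Finset.sum_mul_sum]
  have h1 : ∀ i j, Integrable (fun ω => S.ξ i ω * (W (S.r i) ω - W (S.l i) ω) *
      (S.ξ j ω * (W (S.r j) ω - W (S.l j) ω))) P := fun i j =>
    (S.memLp_integral_term hW ha hb i).integrable_mul (S.memLp_integral_term hW ha hb j)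
  have h2 : ∀ i j, Integrable (fun x : ℝ × Ω =>
      (Set.Ioc (S.l i) (S.r i)).indicator (fun _ => (1 : ℝ)) x.1 * S.ξ i x.2 *
      ((Set.Ioc (S.l j) (S.r j)).indicator (fun _ => (1 : ℝ)) x.1 * S.ξ j x.2))
      ((volume.restrict (Set.Ioc a b)).prod P) := fun i j =>
    (S.memLp_term i 2).integrable_mul (S.memLp_term j 2)
  rw [integral_finsetSum _ fun i _ => integrable_finsetSum _ fun j _ => h1 i j,
    integral_finsetSum _ fun i _ => integrable_finsetSum _ fun j _ => h2 i j]
  refine Finset.sum_congr rfl fun i _ => ?_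
  rw [integral_finsetSum _ fun j _ => h1 i j, integral_finsetSum _ fun j _ => h2 i j]
  refine Finset.sum_congr rfl fun j _ => ?_
  rw [hW.integral_mul_increments (ha.trans (S.a_le i)) (S.l_le_r i) ((S.r_le i).trans hb)
    (ha.trans (S.a_le j)) (S.l_le_r j) ((S.r_le j).trans hb) (S.measurable_ξ i)
    (S.measurable_ξ j) (S.bounded_ξ i) (S.bounded_ξ j)]
  refine Eq.trans ?_ (integral_congr_ae (Eventually.of_forall fun x => mul_mul_mul_comm
    ((Set.Ioc (S.l i) (S.r i)).indicator (fun _ => (1 : ℝ)) x.1)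
    ((Set.Ioc (S.l j) (S.r j)).indicator (fun _ => (1 : ℝ)) x.1) (S.ξ i x.2) (S.ξ j x.2)))
  rw [integral_prod_mul (fun t => (Set.Ioc (S.l i) (S.r i)).indicator (fun _ => (1 : ℝ)) t *
      (Set.Ioc (S.l j) (S.r j)).indicator (fun _ => (1 : ℝ)) t) (fun ω => S.ξ i ω * S.ξ j ω),
    integral_indicator_Ioc_mul_indicator_Ioc (S.a_le i) (S.r_le i), mul_comm]

theorem eLpNorm_two_eq_of_integral_sq_eq {α β : Type*} {mα : MeasurableSpace α}
    {mβ : MeasurableSpace β} {μ : Measure α} {ν : Measure β} {f : α → ℝ} {g : β → ℝ}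
    (hf : MemLp f 2 μ) (hg : MemLp g 2 ν) (h : ∫ x, f x ^ 2 ∂μ = ∫ x, g x ^ 2 ∂ν) :
    eLpNorm f 2 μ = eLpNorm g 2 ν := by
  rw [hf.eLpNorm_eq_integral_rpow_norm (by simp) (by simp),
    hg.eLpNorm_eq_integral_rpow_norm (by simp) (by simp)]
  simp [h]

/-- The Itô isometry for simple processes. -/
theorem SimpleProcess.eLpNorm_integral (S : SimpleProcess 𝓕 a b)
    (hW : IsWienerProcessOn T 𝓕 W P) (ha : 0 ≤ a) (hb : b ≤ T) :
    eLpNorm (S.integral W) 2 P =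
      eLpNorm (fun x : ℝ × Ω => S.val x.1 x.2) 2 ((volume.restrict (Set.Ioc a b)).prod P) :=
  eLpNorm_two_eq_of_integral_sq_eq (S.memLp_integral hW ha hb) (S.memLp_val 2)
    (S.integral_integral_sq hW ha hb)

/-- The difference of two simple processes. -/
def SimpleProcess.sub (S S' : SimpleProcess 𝓕 a b) : SimpleProcess 𝓕 a b where
  -- Since overlaps are allowed, the terms are concatenated and no common refinement is needed.
  n := S.n + S'.n
  l := Fin.append S.l S'.l
  r := Fin.append S.r S'.r
  ξ := Fin.append S.ξ (fun i ω => - S'.ξ i ω)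
  a_le := Fin.addCases (by simpa using S.a_le) (by simpa using S'.a_le)
  l_le_r := Fin.addCases (by simpa using S.l_le_r) (by simpa using S'.l_le_r)
  r_le := Fin.addCases (by simpa using S.r_le) (by simpa using S'.r_le)
  measurable_ξ := Fin.addCases
    (fun i => by rw [Fin.append_left, Fin.append_left]; exact S.measurable_ξ i)
    (fun i => by rw [Fin.append_right, Fin.append_right]; exact (S'.measurable_ξ i).neg)
  bounded_ξ := Fin.addCases (by simpa using S.bounded_ξ) (by simpa using S'.bounded_ξ)

theorem SimpleProcess.sub_val (S S' : SimpleProcess 𝓕 a b) (t : ℝ) (ω : Ω) :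
    (S.sub S').val t ω = S.val t ω - S'.val t ω := by
  simp only [SimpleProcess.val_eq_sum, SimpleProcess.sub]
  rw [Fin.sum_univ_add]
  simp [sub_eq_add_neg]

theorem SimpleProcess.sub_integral (S S' : SimpleProcess 𝓕 a b) (ω : Ω) :
    (S.sub S').integral W ω = S.integral W ω - S'.integral W ω := by
  refine (Fin.sum_univ_add (a := S.n) (b := S'.n) _).trans ?_
  simp [SimpleProcess.integral, SimpleProcess.sub, sub_eq_add_neg]

theorem SimpleProcess.eLpNorm_integral_sub (S S' : SimpleProcess 𝓕 a b)
    (hW : IsWienerProcessOn T 𝓕 W P) (ha : 0 ≤ a) (hb : b ≤ T) :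
    eLpNorm (fun ω => S.integral W ω - S'.integral W ω) 2 P =
      eLpNorm (fun x : ℝ × Ω => S.val x.1 x.2 - S'.val x.1 x.2) 2
        ((volume.restrict (Set.Ioc a b)).prod P) := by
  have h := (S.sub S').eLpNorm_integral hW ha hb
  have e : (S.sub S').integral W = fun ω => S.integral W ω - S'.integral W ω :=
    funext (S.sub_integral S')
  rw [e] at h
  simpa only [SimpleProcess.sub_val] using h

end Isometry

/-! ### Riemann sums converge to the Itô integral -/

section Riemann

variable {Ω : Type*} {mΩ : MeasurableSpace Ω} {a b : ℝ}

/-- The left end point of the `k`-th of `n` equal parts of `[a, b]`. -/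
noncomputable def partPoint (a b : ℝ) (n k : ℕ) : ℝ := a + k * ((b - a) / n)

theorem partPoint_succ_sub (a b : ℝ) (n k : ℕ) :
    partPoint a b n (k + 1) - partPoint a b n k = (b - a) / n := by
  simp only [partPoint]; push_cast; ring

theorem le_partPoint (hab : a ≤ b) (n k : ℕ) : a ≤ partPoint a b n k :=
  le_add_of_nonneg_right (mul_nonneg (by positivity)
    (div_nonneg (sub_nonneg.2 hab) (by positivity)))

theorem partPoint_le_succ (hab : a ≤ b) (n k : ℕ) :
    partPoint a b n k ≤ partPoint a b n (k + 1) := by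
  rw [← sub_nonneg, partPoint_succ_sub]
  exact div_nonneg (sub_nonneg.2 hab) (by positivity)

theorem partPoint_le (hab : a ≤ b) {n k : ℕ} (hk : k ≤ n) : partPoint a b n k ≤ b := by
  rcases Nat.eq_zero_or_pos n with rfl | hn
  · simpa [partPoint] using hab
  have h1 : (k : ℝ) ≤ n := by exact_mod_cast hk
  have h2 : (n : ℝ) * ((b - a) / n) = b - a := by field_simp
  have h3 := mul_le_mul_of_nonneg_right h1
    (div_nonneg (sub_nonneg.2 hab) (Nat.cast_nonneg n) : 0 ≤ (b - a) / n)
  rw [partPoint]; linarith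

/-- The simple process with the values of `f` at the left end points of `n` equal parts. -/
noncomputable def stepProcess (𝓕 : Filtration ℝ mΩ) (hab : a ≤ b) (f : ℝ → ℝ) (n : ℕ) :
    SimpleProcess 𝓕 a b where
  n := n
  l k := partPoint a b n k
  r k := partPoint a b n (k + 1)
  ξ k _ := f (partPoint a b n k)
  a_le k := le_partPoint hab n k
  l_le_r k := partPoint_le_succ hab n k
  r_le k := partPoint_le hab k.2
  measurable_ξ _ := measurable_const
  bounded_ξ _ := ⟨_, fun _ => le_rfl⟩

variable {𝓕 : Filtration ℝ mΩ}

theorem stepProcess_integral (hab : a ≤ b) (f : ℝ → ℝ) (n : ℕ) (W : ℝ → Ω → ℝ) (ω : Ω) :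
    (stepProcess 𝓕 hab f n).integral W ω = ∑ k ∈ Finset.range n,
      f (partPoint a b n k) * (W (partPoint a b n (k + 1)) ω - W (partPoint a b n k) ω) :=
  (Finset.sum_range fun k => f (partPoint a b n k) *
    (W (partPoint a b n (k + 1)) ω - W (partPoint a b n k) ω)).symm

/-- Only the part containing `t` contributes, and its left end point lies within one mesh width of
`t`. This prepares the use of uniform continuity. -/
theorem exists_stepProcess_val_eq (hab : a ≤ b) (f : ℝ → ℝ) {n : ℕ} (hn : 0 < n) {t : ℝ}
    (ht : t ∈ Set.Ioc a b) : ∃ s ∈ Set.Icc a b, |s - t| ≤ (b - a) / n ∧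
      ∀ ω, (stepProcess 𝓕 hab f n).val t ω = f s := by
  have hlt : 0 < b - a := sub_pos.2 (ht.1.trans_le ht.2)
  have hn' : (0 : ℝ) < n := by exact_mod_cast hn
  have hδ : 0 < (b - a) / n := by positivity
  have hmono : ∀ i j : ℕ, i ≤ j → partPoint a b n i ≤ partPoint a b n j := fun i j hij =>
    monotone_nat_of_le_succ (partPoint_le_succ hab n) hij
  -- The parts are open on the left, so the index of the part containing `t` is the ceiling minus
  -- one.
  obtain ⟨m, hm⟩ : ∃ m, ⌈(t - a) / ((b - a) / n)⌉₊ = m + 1 :=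
    Nat.exists_eq_add_one.2 (Nat.ceil_pos.2 (div_pos (sub_pos.2 ht.1) hδ))
  have h1 : t ≤ partPoint a b n (m + 1) := by
    have := Nat.le_ceil ((t - a) / ((b - a) / n))
    rw [hm, div_le_iff₀ hδ] at this
    rw [partPoint]; linarith
  have h2 : partPoint a b n m < t := by
    have := (Nat.lt_ceil (n := m) (a := (t - a) / ((b - a) / n))).1 (by omega)
    rw [lt_div_iff₀ hδ] at this
    rw [partPoint]; linarith
  have hmn : m < n := by
    by_contra h
    have h3 := hmono n m (not_lt.1 h)
    have h4 : partPoint a b n n = b := by rw [partPoint]; field_simp; ring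
    linarith [ht.2]
  refine ⟨partPoint a b n m, ⟨le_partPoint hab n m, partPoint_le hab hmn.le⟩, ?_, fun ω => ?_⟩
  · have := partPoint_succ_sub a b n m
    rw [abs_le]; constructor <;> linarith
  · refine (Finset.sum_eq_single (⟨m, hmn⟩ : Fin n) (fun k _ hk => ?_)
      fun h => absurd (Finset.mem_univ _) h).trans ?_
    · refine Set.indicator_of_notMem (fun hmem => hk ?_) _
      have h3 : partPoint a b n k < t := hmem.1
      have h4 : t ≤ partPoint a b n (k + 1) := hmem.2
      refine Fin.ext (le_antisymm ?_ ?_)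
      · by_contra h
        exact absurd (hmono (m + 1) k (by simpa using h)) (by linarith)
      · by_contra h
        exact absurd (hmono (k + 1) m (by simpa using h)) (by linarith)
    · exact Set.indicator_of_mem (show t ∈ Set.Ioc _ _ from ⟨h2, h1⟩) _

variable {P : Measure Ω} [IsProbabilityMeasure P]

/-- Uniform continuity of `f` gives a uniform bound for fine meshes, which controls the `L²` norm
because the measure is finite. -/
theorem tendsto_eLpNorm_stepProcess_val_sub (hab : a ≤ b) {f g : ℝ → ℝ}
    (hf : ContinuousOn f (Set.Icc a b)) (hfg : f =ᵐ[volume.restrict (Set.Ioc a b)] g) :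
    Tendsto (fun n => eLpNorm
      (fun q : ℝ × Ω => (stepProcess 𝓕 hab f n).val q.1 q.2 - g q.1) 2
      ((volume.restrict (Set.Ioc a b)).prod P)) atTop (𝓝 0) := by
  set μ := (volume.restrict (Set.Ioc a b)).prod P with hμ
  have hμt : μ Set.univ ^ ((2 : ENNReal).toReal)⁻¹ ≠ ⊤ :=
    ENNReal.rpow_ne_top_of_nonneg (by positivity) (measure_ne_top _ _)
  have hae : ∀ᵐ q ∂μ, q.1 ∈ Set.Ioc a b ∧ f q.1 = g q.1 :=
    Measure.quasiMeasurePreserving_fst.ae ((ae_restrict_mem measurableSet_Ioc).and hfg)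
  have hu := isCompact_Icc.uniformContinuousOn_of_continuous hf
  rw [Metric.uniformContinuousOn_iff_le] at hu
  refine ENNReal.tendsto_nhds_zero.2 fun ε hε => ?_
  obtain ⟨δ, hδ, hδε⟩ : ∃ δ : ℝ, 0 < δ ∧
      μ Set.univ ^ ((2 : ENNReal).toReal)⁻¹ * ENNReal.ofReal δ ≤ ε := by
    have h1 : Tendsto (fun δ : ℝ => μ Set.univ ^ ((2 : ENNReal).toReal)⁻¹ * ENNReal.ofReal δ)
        (𝓝[>] 0) (𝓝 0) := by
      have := ENNReal.Tendsto.const_mul (a := μ Set.univ ^ ((2 : ENNReal).toReal)⁻¹)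
        (ENNReal.tendsto_ofReal (tendsto_nhdsWithin_of_tendsto_nhds
          (tendsto_id : Tendsto id (𝓝 (0 : ℝ)) (𝓝 0)) (s := Set.Ioi 0))) (Or.inr hμt)
      simpa using this
    obtain ⟨δ, h2, h3⟩ := ((ENNReal.tendsto_nhds_zero.1 h1 ε hε).and self_mem_nhdsWithin).exists
    exact ⟨δ, h3, h2⟩
  obtain ⟨η, hη, hηf⟩ := hu δ hδ
  have hlim : Tendsto (fun n : ℕ => (b - a) / n) atTop (𝓝 0) :=
    tendsto_const_div_atTop_nhds_zero_nat _
  filter_upwards [hlim.eventually (ge_mem_nhds hη), eventually_gt_atTop 0] with n hn hn0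
  refine (eLpNorm_le_of_ae_bound (C := δ) ?_).trans hδε
  filter_upwards [hae] with q hq
  obtain ⟨s, hs, hst, hv⟩ := exists_stepProcess_val_eq (𝓕 := 𝓕) hab f hn0 hq.1
  rw [hv, ← hq.2]
  exact hηf s hs q.1 (Set.Ioc_subset_Icc_self hq.1) (hst.trans hn)

theorem memLp_comp_fst_of_ae_eq {f g : ℝ → ℝ}
    (hf : ContinuousOn f (Set.Icc a b)) (hfg : f =ᵐ[volume.restrict (Set.Ioc a b)] g) :
    MemLp (fun q : ℝ × Ω => g q.1) 2 ((volume.restrict (Set.Ioc a b)).prod P) := by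
  refine MemLp.comp_fst (f := g) ?_ P
  obtain ⟨K, hK⟩ := isCompact_Icc.exists_bound_of_continuousOn hf
  refine MemLp.ae_eq hfg (MemLp.of_bound
    ((hf.mono Set.Ioc_subset_Icc_self).aestronglyMeasurable measurableSet_Ioc) K ?_)
  filter_upwards [ae_restrict_mem measurableSet_Ioc] with t ht
  exact hK t (Set.Ioc_subset_Icc_self ht)

variable {T : ℝ} {W : ℝ → Ω → ℝ}

theorem eLpNorm_sub_le_add {α : Type*} {mα : MeasurableSpace α} {μ : Measure α} {u v w : α → ℝ}
    (hu : AEStronglyMeasurable u μ) (hv : AEStronglyMeasurable v μ)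
    (hw : AEStronglyMeasurable w μ) :
    eLpNorm (fun x => u x - v x) 2 μ ≤
      eLpNorm (fun x => u x - w x) 2 μ + eLpNorm (fun x => v x - w x) 2 μ := by
  have h := eLpNorm_sub_le (hu.sub hw) (hv.sub hw) (p := 2) (by norm_num)
  refine le_trans (le_of_eq ?_) h
  congr 1; funext x; simp

/-- A process that is almost everywhere equal to a deterministic continuous function has an
Itô integral. -/
theorem itoIntegrable_of_ae_eq_continuousOn (hW : IsWienerProcessOn T 𝓕 W P) (ha : 0 ≤ a)
    (hab : a ≤ b) (hb : b ≤ T) {f g : ℝ → ℝ} (hf : ContinuousOn f (Set.Icc a b))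
    (hfg : f =ᵐ[volume.restrict (Set.Ioc a b)] g) :
    ItoIntegrable 𝓕 W P a b (fun t _ => g t) := by
  set S := fun n => stepProcess 𝓕 hab f n
  have hS := tendsto_eLpNorm_stepProcess_val_sub (𝓕 := 𝓕) (P := P) hab hf hfg
  have hG := memLp_comp_fst_of_ae_eq (P := P) hf hfg
  have hm : ∀ n, MemLp ((S n).integral W) 2 P := fun n => (S n).memLp_integral hW ha hb
  -- The isometry transfers the Cauchy property from the step processes to their integrals;
  -- completeness of `L²` then supplies the integral.
  have hc : CauchySeq fun n => (hm n).toLp ((S n).integral W) := by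
    rw [EMetric.cauchySeq_iff]
    intro ε hε
    have h1 := (ENNReal.tendsto_nhds_zero.1 hS (ε / 3) (ENNReal.div_pos hε.ne' (by simp)))
    by_cases hεt : ε = ⊤
    · exact ⟨0, fun m _ n _ => by rw [hεt]; exact edist_lt_top _ _⟩
    obtain ⟨N, hN⟩ := eventually_atTop.1 h1
    refine ⟨N, fun m hm' n hn' => ?_⟩
    rw [Lp.edist_toLp_toLp]
    have e : (S m).integral W - (S n).integral W =
      fun ω => (S m).integral W ω - (S n).integral W ω := rfl
    rw [e, (S m).eLpNorm_integral_sub (S n) hW ha hb]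
    refine (eLpNorm_sub_le_add ((S m).memLp_val 2).1 ((S n).memLp_val 2).1 hG.1).trans_lt
      ((add_le_add (hN m hm') (hN n hn')).trans_lt ?_)
    calc ε / 3 + ε / 3 < ε / 3 + ε / 3 + ε / 3 := by
          refine ENNReal.lt_add_right ?_ (ENNReal.div_pos hε.ne' (by simp)).ne'
          simp [ENNReal.div_eq_top, hεt]
      _ = ε := ENNReal.add_thirds ε
  obtain ⟨X, hX⟩ := cauchySeq_tendsto_of_complete hc
  refine ⟨X, hG, Lp.memLp X, S, hS, ?_⟩
  have hX' : Tendsto (fun n => (hm n).toLp ((S n).integral W)) atTop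
      (𝓝 ((Lp.memLp X).toLp X)) := by rwa [Lp.toLp_coeFn]
  exact (Lp.tendsto_Lp_iff_tendsto_eLpNorm'' _ hm _ (Lp.memLp X)).1 hX'

/-- The Riemann sums converge to every version of the Itô integral. -/
theorem IsItoIntegral.tendsto_stepProcess (hW : IsWienerProcessOn T 𝓕 W P) (ha : 0 ≤ a)
    (hab : a ≤ b) (hb : b ≤ T) {f g : ℝ → ℝ} (hf : ContinuousOn f (Set.Icc a b))
    (hfg : f =ᵐ[volume.restrict (Set.Ioc a b)] g) {X : Ω → ℝ}
    (hX : IsItoIntegral 𝓕 W P a b (fun t _ => g t) X) :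
    Tendsto (fun n => eLpNorm (fun ω => (stepProcess 𝓕 hab f n).integral W ω - X ω) 2 P)
      atTop (𝓝 0) := by
  obtain ⟨hG, hX2, S, hS, hSX⟩ := hX
  have hD := tendsto_eLpNorm_stepProcess_val_sub (𝓕 := 𝓕) (P := P) hab hf hfg
  refine tendsto_of_tendsto_of_tendsto_of_le_of_le tendsto_const_nhds
    (show Tendsto _ atTop (𝓝 (0 : ENNReal)) by simpa using (hD.add hS).add hSX)
    (fun _ => zero_le) fun n => ?_
  -- The integrals of `D` and of the given `S n` are compared through the isometry, as both
  -- processes converge to `g`.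
  set D := stepProcess 𝓕 hab f n
  have h1 := eLpNorm_add_le (p := 2)
    ((D.memLp_integral hW ha hb).1.sub ((S n).memLp_integral hW ha hb).1)
    (((S n).memLp_integral hW ha hb).1.sub hX2.1) (by norm_num)
  have h2 : eLpNorm (D.integral W - (S n).integral W) 2 P ≤ _ :=
    (D.eLpNorm_integral_sub (S n) hW ha hb).le.trans
      (eLpNorm_sub_le_add (D.memLp_val 2).1 ((S n).memLp_val 2).1 hG.1)
  rw [sub_add_sub_cancel] at h1
  exact h1.trans (add_le_add h2 le_rfl)

theorem tendsto_eLpNorm_riemannSum_sub_itoIntegral (hW : IsWienerProcessOn T 𝓕 W P) (ha : 0 ≤ a)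
    (hab : a ≤ b) (hb : b ≤ T) {f g : ℝ → ℝ} (hf : ContinuousOn f (Set.Icc a b))
    (hfg : f =ᵐ[volume.restrict (Set.Ioc a b)] g) :
    Tendsto (fun n : ℕ => eLpNorm (fun ω => (∑ k ∈ Finset.range n,
      f (partPoint a b n k) * (W (partPoint a b n (k + 1)) ω - W (partPoint a b n k) ω)) -
        itoIntegral 𝓕 W P a b (fun t _ => g t) ω) 2 P) atTop (𝓝 0) := by
  have h := itoIntegrable_of_ae_eq_continuousOn hW ha hab hb hf hfg
  have hX : IsItoIntegral 𝓕 W P a b (fun t _ => g t)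
      (itoIntegral 𝓕 W P a b (fun t _ => g t)) := by
    rw [itoIntegral, dif_pos h]
    exact h.choose_spec
  simpa only [stepProcess_integral] using hX.tendsto_stepProcess hW ha hab hb hf hfg

theorem aestronglyMeasurable_itoIntegral (𝓕 : Filtration ℝ mΩ) (W : ℝ → Ω → ℝ) (P : Measure Ω)
    (a b : ℝ) (G : ℝ → Ω → ℝ) : AEStronglyMeasurable (itoIntegral 𝓕 W P a b G) P := by
  rw [itoIntegral]
  split_ifs with h
  · exact h.choose_spec.2.1.1
  · exact aestronglyMeasurable_zero

end Riemann

/-! ### Moments of sums of Gaussian increments -/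

section Gaussian

variable {Ω : Type*} {mΩ : MeasurableSpace Ω} {P : Measure Ω} {T : ℝ} {𝓕 : Filtration ℝ mΩ}
  {W : ℝ → Ω → ℝ}

theorem integrable_exp_mul_id_gaussianReal (v : NNReal) (a : ℝ) :
    Integrable (fun x => Real.exp (a * x)) (gaussianReal 0 v) :=
  integrable_exp_mul_gaussianReal a

theorem integral_exp_mul_id_gaussianReal (v : NNReal) (a : ℝ) :
    ∫ x, Real.exp (a * x) ∂(gaussianReal 0 v) = Real.exp (v * a ^ 2 / 2) := by
  have h := mgf_gaussianReal (p := gaussianReal 0 v) (X := id) (μ := 0) (v := v)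
    Measure.map_id a
  simpa [mgf] using h

/-- The `p`-norm of a centred Gaussian variable is at most `√p` times its standard deviation. -/
theorem eLpNorm_id_gaussianReal_le {p : ℝ} (hp : 2 ≤ p) (v : NNReal) :
    eLpNorm id (ENNReal.ofReal p) (gaussianReal 0 v) ≤ ENNReal.ofReal (√p * √v) := by
  have hp0 : 0 < p := by linarith
  rcases eq_or_ne v 0 with rfl | hv
  · rw [gaussianReal_zero_var]
    have : (id : ℝ → ℝ) =ᵐ[Measure.dirac 0] 0 := by
      rw [Filter.EventuallyEq, ae_dirac_eq]; simp
    rw [eLpNorm_congr_ae this]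
    simp
  have hv0 : 0 < √(v : ℝ) := Real.sqrt_pos.2 (by positivity)
  have hps : 0 < √p := Real.sqrt_pos.2 hp0
  set c := √p * √(v : ℝ) with hc
  have hc0 : 0 < c := by positivity
  set a := √p / √(v : ℝ) with ha
  have hca : p / c = a := by
    rw [hc, ha, div_eq_div_iff (by positivity) (by positivity)]
    nlinarith [Real.mul_self_sqrt hp0.le]
  have hva : (v : ℝ) * a ^ 2 = p := by
    rw [ha, div_pow, Real.sq_sqrt hp0.le, Real.sq_sqrt v.coe_nonneg]
    field_simp
  -- From `y ≤ exp (y - 1)` with `y = |x| / c`. The choice of `c` gives `a = p / c` and `v a² = p`,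
  -- so each exponential has expectation `exp (p / 2)`.
  have hpt : ∀ x : ℝ, |x| ^ p ≤
      c ^ p * Real.exp (-p) * (Real.exp (a * x) + Real.exp (-a * x)) := by
    intro x
    have h1 : (|x| / c) ^ p ≤ Real.exp (p * (|x| / c) - p) := by
      have h2 := Real.add_one_le_exp (|x| / c - 1)
      rw [sub_add_cancel] at h2
      refine (Real.rpow_le_rpow (by positivity) h2 hp0.le).trans (le_of_eq ?_)
      rw [← Real.exp_mul]; congr 1; ring
    have h3 : p * (|x| / c) = a * |x| := by rw [← hca]; ring
    have h4 : Real.exp (a * |x|) ≤ Real.exp (a * x) + Real.exp (-a * x) := by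
      rcases abs_cases x with ⟨h, _⟩ | ⟨h, _⟩
      · rw [h]; linarith [Real.exp_pos (-a * x)]
      · rw [h, mul_neg, ← neg_mul]; linarith [Real.exp_pos (a * x)]
    rw [h3, sub_eq_add_neg, Real.exp_add, Real.div_rpow (abs_nonneg _) hc0.le,
      div_le_iff₀ (by positivity)] at h1
    refine h1.trans ?_
    have h5 := mul_le_mul_of_nonneg_left h4
      (show 0 ≤ c ^ p * Real.exp (-p) by positivity)
    linarith
  have hint := ((integrable_exp_mul_id_gaussianReal v a).add
    (integrable_exp_mul_id_gaussianReal v (-a))).const_mul (c ^ p * Real.exp (-p))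
  have hval : ∫ x, c ^ p * Real.exp (-p) * (Real.exp (a * x) + Real.exp (-a * x))
      ∂(gaussianReal 0 v) ≤ c ^ p := by
    rw [integral_const_mul, integral_add (integrable_exp_mul_id_gaussianReal v a)
      (integrable_exp_mul_id_gaussianReal v (-a)), integral_exp_mul_id_gaussianReal,
      integral_exp_mul_id_gaussianReal, neg_sq, hva, ← two_mul]
    have h1 : Real.exp (-p) * (2 * Real.exp (p / 2)) = 2 * Real.exp (-(p / 2)) := by
      rw [mul_left_comm, ← Real.exp_add]; congr 2; ring
    -- Here `p ≥ 2` enters: `exp (p / 2) ≥ 1 + p / 2 ≥ 2`.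
    have h2 : 2 * Real.exp (-(p / 2)) ≤ 1 := by
      rw [Real.exp_neg, ← div_eq_mul_inv, div_le_one (Real.exp_pos _)]
      linarith [Real.add_one_le_exp (p / 2)]
    rw [mul_assoc, h1]
    exact mul_le_of_le_one_right (by positivity) h2
  rw [eLpNorm_eq_lintegral_rpow_enorm_toReal (by simpa using hp0) ENNReal.ofReal_ne_top,
    ENNReal.toReal_ofReal hp0.le]
  have hle : ∫⁻ x, ‖id x‖ₑ ^ p ∂(gaussianReal 0 v) ≤ ENNReal.ofReal (c ^ p) := by
    refine le_trans ?_ (ENNReal.ofReal_le_ofReal hval)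
    have hint' := ofReal_integral_eq_lintegral_ofReal hint
      (Eventually.of_forall fun x => by simp only [Pi.add_apply]; positivity)
    simp only [Pi.add_apply] at hint'
    rw [hint']
    refine lintegral_mono fun x => ?_
    rw [Real.enorm_eq_ofReal_abs, ENNReal.ofReal_rpow_of_nonneg (abs_nonneg _) hp0.le]
    exact ENNReal.ofReal_le_ofReal (hpt x)
  refine (ENNReal.rpow_le_rpow hle (by positivity)).trans (le_of_eq ?_)
  rw [ENNReal.ofReal_rpow_of_nonneg (by positivity) (by positivity), ← Real.rpow_mul hc0.le,
    mul_one_div_cancel hp0.ne', Real.rpow_one]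

theorem eLpNorm_le_of_hasLaw_gaussianReal {p : ℝ} (hp : 2 ≤ p) {v : NNReal} {X : Ω → ℝ}
    (hX : HasLaw X (gaussianReal 0 v) P) :
    eLpNorm X (ENNReal.ofReal p) P ≤ ENNReal.ofReal (√p * √v) := by
  have h := eLpNorm_id_gaussianReal_le hp v
  rwa [← hX.map_eq, eLpNorm_map_measure aestronglyMeasurable_id hX.aemeasurable] at h

/-- Independent centred Gaussians add, and so do their variances. Measurability at time `s m` is
part of the induction because it makes the partial sum independent of the next increment. -/
theorem IsWienerProcessOn.hasLaw_sum_increments [IsProbabilityMeasure P]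
    (hW : IsWienerProcessOn T 𝓕 W P)
    {s : ℕ → ℝ} (hs : Monotone s) (h0 : 0 ≤ s 0) (c : ℕ → ℝ) (m : ℕ) (hm : s m ≤ T) :
    Measurable[𝓕 (s m)]
      (fun ω => ∑ k ∈ Finset.range m, c k * (W (s (k + 1)) ω - W (s k) ω)) ∧
    HasLaw (fun ω => ∑ k ∈ Finset.range m, c k * (W (s (k + 1)) ω - W (s k) ω))
      (gaussianReal 0 (∑ k ∈ Finset.range m, c k ^ 2 * (s (k + 1) - s k)).toNNReal) P := by
  induction m with
  | zero =>
    simp only [Finset.range_zero, Finset.sum_empty, Real.toNNReal_zero, gaussianReal_zero_var]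
    exact ⟨measurable_const, ⟨aemeasurable_const, by simp⟩⟩
  | succ m ih =>
    have hmm : s m ≤ s (m + 1) := hs (Nat.le_succ m)
    have h0m : 0 ≤ s m := h0.trans (hs (Nat.zero_le m))
    obtain ⟨ihm, ihl⟩ := ih (hmm.trans hm)
    have hind := (hW.indepFun_increment h0m hmm hm ihm).comp measurable_id
      (measurable_id.const_mul (c m))
    have hl := gaussianReal_const_mul (hW.gaussian_increments (s m) (s (m + 1)) h0m hmm hm) (c m)
    have hsum := gaussianReal_add_gaussianReal_of_indepFun hind ihl.map_eq hl.map_eq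
    simp only [Finset.sum_range_succ]
    have hmeas : Measurable[𝓕 (s (m + 1))] (fun ω =>
        ∑ k ∈ Finset.range m, c k * (W (s (k + 1)) ω - W (s k) ω) +
        c m * (W (s (m + 1)) ω - W (s m) ω)) :=
      Measurable.add (ihm.mono (𝓕.mono hmm) le_rfl)
        (Measurable.const_mul (hW.measurable_increment h0m hmm hm) (c m))
    refine ⟨hmeas, ⟨(hmeas.mono (𝓕.le _) le_rfl).aemeasurable, ?_⟩⟩
    refine Eq.trans hsum ?_
    rw [mul_zero, add_zero, Real.toNNReal_add
      (Finset.sum_nonneg fun k _ => mul_nonneg (sq_nonneg _) (sub_nonneg.2 (hs (Nat.le_succ k))))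
      (mul_nonneg (sq_nonneg _) (sub_nonneg.2 hmm)), Real.toNNReal_mul (sq_nonneg _)]
    congr 3
    exact (Real.toNNReal_of_nonneg _).symm

theorem IsWienerProcessOn.eLpNorm_sum_increments_le [IsProbabilityMeasure P]
    (hW : IsWienerProcessOn T 𝓕 W P) {p : ℝ} (hp : 2 ≤ p)
    {s : ℕ → ℝ} (hs : Monotone s) (h0 : 0 ≤ s 0) (c : ℕ → ℝ) (m : ℕ) (hm : s m ≤ T) {B : ℝ}
    (hB : ∑ k ∈ Finset.range m, c k ^ 2 * (s (k + 1) - s k) ≤ B ^ 2) (hB0 : 0 ≤ B) :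
    eLpNorm (fun ω => ∑ k ∈ Finset.range m, c k * (W (s (k + 1)) ω - W (s k) ω))
      (ENNReal.ofReal p) P ≤ ENNReal.ofReal (√p * B) := by
  refine (eLpNorm_le_of_hasLaw_gaussianReal hp
    (hW.hasLaw_sum_increments hs h0 c m hm).2).trans (ENNReal.ofReal_le_ofReal ?_)
  refine mul_le_mul_of_nonneg_left (Real.sqrt_le_iff.2 ⟨hB0, ?_⟩) (Real.sqrt_nonneg _)
  rw [Real.coe_toNNReal _ (Finset.sum_nonneg fun k _ =>
    mul_nonneg (sq_nonneg _) (sub_nonneg.2 (hs (Nat.le_succ k))))]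
  exact hB

end Gaussian

/-! ### The error of quadrature rules that are affine on each cell -/

section Quadrature

theorem sum_range_mul_eq_sum_sum {M : Type*} [AddCommMonoid M] (F : ℕ → M) (N n : ℕ) :
    ∑ k ∈ Finset.range (N * n), F k =
      ∑ j ∈ Finset.range N, ∑ i ∈ Finset.range n, F (j * n + i) := by
  induction N with
  | zero => simp
  | succ N ih => rw [Nat.succ_mul, Finset.sum_range_add, ih, Finset.sum_range_succ]

/-- Refining each cell into `n` parts gives the global mesh of `N * n` parts, so all Riemann sums
use the same increments. -/
theorem partPoint_cell (T : ℝ) (N j i : ℕ) {n : ℕ} (hn : 0 < n) :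
    partPoint (gridPoint T N j) (gridPoint T N (j + 1)) n i = partPoint 0 T (N * n) (j * n + i) := by
  have : (n : ℝ) ≠ 0 := by positivity
  rw [partPoint, gridPoint_succ_sub, partPoint, gridPoint]
  push_cast
  rcases Nat.eq_zero_or_pos N with rfl | hN
  · simp
  have : (N : ℝ) ≠ 0 := by positivity
  field_simp
  ring

theorem partPoint_mul (T : ℝ) (N j : ℕ) {n : ℕ} (hn : 0 < n) :
    partPoint 0 T (N * n) (j * n) = gridPoint T N j := by
  have h := partPoint_cell T N j 0 hn
  rw [add_zero] at h
  rw [← h]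
  simp [partPoint]

variable {Ω : Type*} {mΩ : MeasurableSpace Ω} {P : Measure Ω} {T : ℝ}
  {𝓕 : Filtration ℝ mΩ} {W : ℝ → Ω → ℝ}

theorem IsWienerProcessOn.aestronglyMeasurable (hW : IsWienerProcessOn T 𝓕 W P) {t : ℝ}
    (ht : t ∈ Set.Icc 0 T) : AEStronglyMeasurable (W t) P :=
  ((hW.adapted t ht).mono (𝓕.le t) le_rfl).aestronglyMeasurable

variable [IsProbabilityMeasure P]

/-- With all Itô integrals replaced by Riemann sums on the `n`-fold refinement, the error `R n` is a
single sum of weighted increments, with weights at most `D j` in absolute value on cell `j`. Its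
variance is at most `B²` for every `n > 0`. -/
theorem IsWienerProcessOn.eLpNorm_itoIntegral_sub_affine_le (hW : IsWienerProcessOn T 𝓕 W P)
    (hT : 0 < T) {p : ℝ} (hp : 2 ≤ p) {N : ℕ} (hN : 0 < N) {f g : ℝ → ℝ}
    (hf : ContinuousOn f (Set.Icc 0 T)) (hfg : f =ᵐ[volume.restrict (Set.Ioc 0 T)] g)
    {α β D : ℕ → ℝ} {B : ℝ} (hB0 : 0 ≤ B)
    (hD : ∀ j < N, ∀ t ∈ Set.Icc (gridPoint T N j) (gridPoint T N (j + 1)),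
      |f t - (α j + β j * (t - (gridPoint T N j + gridPoint T N (j + 1)) / 2))| ≤ D j)
    (hB : ∑ j ∈ Finset.range N, T / N * D j ^ 2 ≤ B ^ 2) :
    eLpNorm (fun ω => itoIntegral 𝓕 W P 0 T (fun t _ => g t) ω -
      ((∑ j ∈ Finset.range N, α j * (W (gridPoint T N (j + 1)) ω - W (gridPoint T N j) ω)) +
        ∑ j ∈ Finset.range N, β j * cellIntegral 𝓕 W P T N j ω)) (ENNReal.ofReal p) P ≤
      ENNReal.ofReal (√p * B) := by
  set τ := gridPoint T N with hτ
  set mid := fun j => (τ j + τ (j + 1)) / 2 with hmid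
  have hτ0 : ∀ j, 0 ≤ τ j := gridPoint_nonneg hT.le N
  have hτle : ∀ j, τ j ≤ τ (j + 1) := fun j => (gridPoint_lt_succ hT hN j).le
  have hτT : ∀ j < N, τ (j + 1) ≤ T := fun j hj => gridPoint_le hT.le hN hj
  let Z : ℕ → ℕ → Ω → ℝ := fun j n ω => ∑ i ∈ Finset.range n,
    (partPoint (τ j) (τ (j + 1)) n i - mid j) * (W (partPoint (τ j) (τ (j + 1)) n (i + 1)) ω -
      W (partPoint (τ j) (τ (j + 1)) n i) ω)
  let Y : ℕ → Ω → ℝ := fun n ω => ∑ k ∈ Finset.range n,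
    f (partPoint 0 T n k) * (W (partPoint 0 T n (k + 1)) ω - W (partPoint 0 T n k) ω)
  let A : Ω → ℝ := fun ω => ∑ j ∈ Finset.range N, α j * (W (τ (j + 1)) ω - W (τ j) ω)
  let X : Ω → ℝ := itoIntegral 𝓕 W P 0 T (fun t _ => g t)
  let C : ℕ → Ω → ℝ := cellIntegral 𝓕 W P T N
  have hY : Tendsto (fun n : ℕ => eLpNorm (fun ω => Y (N * n) ω - X ω) 2 P) atTop (𝓝 0) :=
    (tendsto_eLpNorm_riemannSum_sub_itoIntegral hW le_rfl hT.le le_rfl hf hfg).comp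
      (tendsto_id.const_mul_atTop' hN)
  have hZ : ∀ j < N, Tendsto (fun n : ℕ => eLpNorm (fun ω => Z j n ω - C j ω) 2 P) atTop (𝓝 0) :=
    fun j hj => tendsto_eLpNorm_riemannSum_sub_itoIntegral (f := fun t => t - mid j) hW (hτ0 j)
      (hτle j) (hτT j hj) (by fun_prop) EventuallyEq.rfl
  have hXm : AEStronglyMeasurable X P := aestronglyMeasurable_itoIntegral _ _ _ _ _ _
  have hCm : ∀ j, AEStronglyMeasurable (C j) P := fun j =>
    aestronglyMeasurable_itoIntegral _ _ _ _ _ _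
  have hWp : ∀ {a b : ℝ} {n k : ℕ}, 0 ≤ a → a ≤ b → b ≤ T → k ≤ n →
      AEStronglyMeasurable (W (partPoint a b n k)) P := fun ha hab hb hk =>
    hW.aestronglyMeasurable ⟨ha.trans (le_partPoint hab _ _), (partPoint_le hab hk).trans hb⟩
  have hYm : ∀ n, AEStronglyMeasurable (Y n) P := fun n =>
    Finset.aestronglyMeasurable_fun_sum _ fun k hk =>
      ((hWp le_rfl hT.le le_rfl (Finset.mem_range.1 hk)).sub
        (hWp le_rfl hT.le le_rfl (Finset.mem_range.1 hk).le)).const_mul _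
  have hZm : ∀ j < N, ∀ n, AEStronglyMeasurable (Z j n) P := fun j hj n =>
    Finset.aestronglyMeasurable_fun_sum _ fun k hk =>
      ((hWp (hτ0 j) (hτle j) (hτT j hj) (Finset.mem_range.1 hk)).sub
        (hWp (hτ0 j) (hτle j) (hτT j hj) (Finset.mem_range.1 hk).le)).const_mul _
  have hAm : AEStronglyMeasurable A P :=
    Finset.aestronglyMeasurable_fun_sum _ fun j hj =>
      ((hW.aestronglyMeasurable ⟨hτ0 _, hτT j (Finset.mem_range.1 hj)⟩).sub
        (hW.aestronglyMeasurable ⟨hτ0 _, (hτle j).trans (hτT j (Finset.mem_range.1 hj))⟩)).const_mul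
          _
  let R : ℕ → Ω → ℝ := fun n ω => Y (N * n) ω - (A ω + ∑ j ∈ Finset.range N, β j * Z j n ω)
  let L : Ω → ℝ := fun ω => X ω - (A ω + ∑ j ∈ Finset.range N, β j * C j ω)
  have hRm : ∀ n, AEStronglyMeasurable (R n) P := fun n =>
    (hYm _).sub (hAm.add (Finset.aestronglyMeasurable_fun_sum _ fun j hj =>
      (hZm j (Finset.mem_range.1 hj) n).const_mul _))
  have hLm : AEStronglyMeasurable L P :=
    hXm.sub (hAm.add (Finset.aestronglyMeasurable_fun_sum _ fun j _ => (hCm j).const_mul _))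
  have hRL : Tendsto (fun n => eLpNorm (R n - L) 2 P) atTop (𝓝 0) := by
    have hlim : Tendsto (fun n => eLpNorm (fun ω => Y (N * n) ω - X ω) 2 P +
        ∑ j ∈ Finset.range N, ‖β j‖ₑ * eLpNorm (fun ω => Z j n ω - C j ω) 2 P) atTop (𝓝 0) := by
      have h1 : ∀ j ∈ Finset.range N, Tendsto
          (fun n => ‖β j‖ₑ * eLpNorm (fun ω => Z j n ω - C j ω) 2 P) atTop (𝓝 0) := fun j hj => by
        simpa using ENNReal.Tendsto.const_mul (hZ j (Finset.mem_range.1 hj)) (Or.inr enorm_ne_top)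
      simpa using hY.add (tendsto_finsetSum _ h1)
    refine tendsto_of_tendsto_of_tendsto_of_le_of_le tendsto_const_nhds hlim
      (fun _ => zero_le) fun n => ?_
    have e : R n - L = (fun ω => Y (N * n) ω - X ω) -
        ∑ j ∈ Finset.range N, β j • (fun ω => Z j n ω - C j ω) := by
      funext ω
      simp only [R, L, Pi.sub_apply, Finset.sum_apply, Pi.smul_apply, smul_eq_mul, mul_sub,
        Finset.sum_sub_distrib]
      ring
    have hm : ∀ j ∈ Finset.range N,
        AEStronglyMeasurable (β j • (fun ω => Z j n ω - C j ω)) P := fun j hj =>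
      ((hZm j (Finset.mem_range.1 hj) n).sub (hCm j)).const_smul _
    rw [e]
    refine (eLpNorm_sub_le ((hYm _).sub hXm) (Finset.aestronglyMeasurable_sum _ hm)
      (by norm_num)).trans (add_le_add le_rfl ((eLpNorm_sum_le hm (by norm_num)).trans
        (Finset.sum_le_sum fun j _ => ?_)))
    rw [eLpNorm_const_smul]
  -- `L²` convergence gives convergence in measure, which suffices to pass an `L^p` bound to the
  -- limit; `L^p` convergence is not needed.
  refine eLpNorm_le_of_tendstoInMeasure (f := R) (g := L) (u := atTop) ?_
    (tendstoInMeasure_of_tendsto_eLpNorm (p := 2) (by norm_num) hRm hLm hRL) hRm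
  filter_upwards [eventually_gt_atTop 0] with n hn
  set s := partPoint 0 T (N * n) with hs
  -- The natural number quotient `k / n` is the index of the cell containing the `k`-th part.
  let c : ℕ → ℝ := fun k => f (s k) - (α (k / n) + β (k / n) * (s k - mid (k / n)))
  have hdiv : ∀ j, ∀ i ∈ Finset.range n, (j * n + i) / n = j := fun j i hi => by
    rw [mul_comm, Nat.mul_add_div hn, Nat.div_eq_of_lt (Finset.mem_range.1 hi), add_zero]
  have hRs : R n = fun ω => ∑ k ∈ Finset.range (N * n), c k * (W (s (k + 1)) ω - W (s k) ω) := by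
    funext ω
    simp only [R, Y, A, Z]
    rw [sum_range_mul_eq_sum_sum, sum_range_mul_eq_sum_sum, ← Finset.sum_add_distrib,
      ← Finset.sum_sub_distrib]
    refine Finset.sum_congr rfl fun j _ => ?_
    -- The increment over a cell telescopes, which puts the `α` terms on the fine mesh too.
    have h1 : W (τ (j + 1)) ω - W (τ j) ω =
        ∑ i ∈ Finset.range n, (W (s (j * n + i + 1)) ω - W (s (j * n + i)) ω) := by
      have := Finset.sum_range_sub (fun i => W (s (j * n + i)) ω) n
      simp only [← add_assoc, add_zero] at this
      rw [this, hs, partPoint_mul T N j hn, ← Nat.succ_mul, partPoint_mul T N _ hn]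
    rw [h1, Finset.mul_sum, Finset.mul_sum, ← Finset.sum_add_distrib, ← Finset.sum_sub_distrib]
    refine Finset.sum_congr rfl fun i hi => ?_
    simp only [c, hdiv j i hi, hτ, partPoint_cell T N j _ hn, ← add_assoc]
    ring
  rw [hRs]
  refine hW.eLpNorm_sum_increments_le hp (monotone_nat_of_le_succ (partPoint_le_succ hT.le _))
    (le_partPoint hT.le _ _) c (N * n) (partPoint_le hT.le le_rfl) (le_trans ?_ hB) hB0
  rw [sum_range_mul_eq_sum_sum]
  refine Finset.sum_le_sum fun j hj => ?_
  have hn0 : (0 : ℝ) < n := by positivity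
  have hN0 : (0 : ℝ) < N := by positivity
  have h2 : ∀ i ∈ Finset.range n, c (j * n + i) ^ 2 * (s (j * n + i + 1) - s (j * n + i)) ≤
      D j ^ 2 * (T / N / n) := fun i hi => by
    have h3 : s (j * n + i + 1) - s (j * n + i) = T / N / n := by
      rw [hs, partPoint_succ_sub]; push_cast; rw [sub_zero, div_div]
    rw [h3]
    refine mul_le_mul_of_nonneg_right ?_ (by positivity)
    rw [← sq_abs]
    refine pow_le_pow_left₀ (abs_nonneg _) ?_ 2
    simp only [c, hdiv j i hi]
    refine hD j (Finset.mem_range.1 hj) _ ?_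
    rw [hs, ← partPoint_cell T N j i hn]
    exact ⟨le_partPoint (hτle j) _ _, partPoint_le (hτle j) (Finset.mem_range.1 hi).le⟩
  refine (Finset.sum_le_sum h2).trans (le_of_eq ?_)
  rw [Finset.sum_const, Finset.card_range, nsmul_eq_mul]
  field_simp

end Quadrature

/-! ### The main theorem -/

/-- For the constant martingale `1` on a one-point space and `n = 0`, both norms equal `1`. -/
theorem IsUpperBDGConstant.one_le {p K : ℝ} (hp : 0 < p) (h : IsUpperBDGConstant p K) :
    1 ≤ K := by
  have h1 := h.2 Unit inferInstance (Measure.dirac ()) inferInstance ⊥ (fun _ _ => 1)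
    (martingale_const _ _ 1) 0
  have h2 : eLpNorm (fun _ : Unit => (1 : ℝ)) (ENNReal.ofReal p) (Measure.dirac ()) = 1 := by
    rw [eLpNorm_const _ (by simpa using hp) (NeZero.ne _)]
    simp
  simpa [h2] using h1

theorem hasWeakDeriv_weakDeriv {T : ℝ} {v : ℝ → ℝ} (h : ∃ w, HasWeakDeriv T v w) :
    HasWeakDeriv T v (weakDeriv T v) := by
  rw [weakDeriv, dif_pos h]
  exact h.choose_spec

/-! ### Elements of `W^{1+σ,p}(0,T)` as primitives of their weak derivatives -/

section Slobodeckij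

variable {σ p T : ℝ} {g : ℝ → ℝ}

theorem MemSlobodeckij.sum_lt_top (hp : 0 < p) (hg : MemSlobodeckij σ p T g) :
    (∫⁻ t in Set.Ioo 0 T, ENNReal.ofReal (|g t| ^ p)) +
      (∫⁻ t in Set.Ioo 0 T, ENNReal.ofReal (|weakDeriv T g t| ^ p)) +
      (∫⁻ s in Set.Ioo 0 T, ∫⁻ t in Set.Ioo 0 T, ENNReal.ofReal
        (|weakDeriv T g t - weakDeriv T g s| ^ p / |t - s| ^ (1 + σ * p))) < ⊤ := by
  have h := hg.2.2
  rwa [slobodeckijNorm, ENNReal.rpow_lt_top_iff_of_pos (by positivity)] at h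

theorem MemSlobodeckij.integrableOn (hp : 1 ≤ p) (hg : MemSlobodeckij σ p T g) :
    IntegrableOn g (Set.Ioo 0 T) :=
  hg.1.integrable (by simpa using hp)

theorem MemSlobodeckij.integrableOn_weakDeriv (hp : 1 ≤ p) (hg : MemSlobodeckij σ p T g) :
    IntegrableOn (weakDeriv T g) (Set.Ioo 0 T) := by
  have hp0 : 0 < p := by linarith
  have hm := (hasWeakDeriv_weakDeriv hg.2.1).2.1.aestronglyMeasurable
  refine MemLp.integrable (q := ENNReal.ofReal p) (by simpa using hp) ⟨hm, ?_⟩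
  have h := hg.sum_lt_top hp0
  rw [ENNReal.add_lt_top, ENNReal.add_lt_top] at h
  rw [eLpNorm_lt_top_iff_lintegral_rpow_enorm_lt_top (by simpa using hp0) ENNReal.ofReal_ne_top,
    ENNReal.toReal_ofReal hp0.le]
  simp_rw [Real.enorm_eq_ofReal_abs, ENNReal.ofReal_rpow_of_nonneg (abs_nonneg _) hp0.le]
  exact h.1.2

theorem continuousOn_const_add_integral (hT : 0 < T) {w : ℝ → ℝ}
    (hw : IntegrableOn w (Set.Ioo 0 T)) (c : ℝ) :
    ContinuousOn (fun x => c + ∫ t in (0)..x, w t) (Set.Icc 0 T) := by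
  have hwi : IntervalIntegrable w volume 0 T := by
    rwa [intervalIntegrable_iff_integrableOn_Ioo_of_le hT.le]
  have := (hwi.absolutelyContinuousOnInterval_intervalIntegral
    (c := 0) Set.left_mem_uIcc).continuousOn
  rw [Set.uIcc_of_le hT.le] at this
  exact continuousOn_const.add this

theorem MemSlobodeckij.exists_isContinuousRepresentative (hT : 0 < T) (hp : 1 ≤ p)
    (hg : MemSlobodeckij σ p T g) : ∃ f, IsContinuousRepresentative T g f := by
  have hw := hg.integrableOn_weakDeriv hp
  obtain ⟨c, hc⟩ := (hasWeakDeriv_weakDeriv hg.2.1).exists_ae_eq_const_add_integral hT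
    (hg.integrableOn hp) hw
  exact ⟨_, continuousOn_const_add_integral hT hw c, hc.symm⟩

/-- Two continuous functions that agree a.e. agree everywhere on `[0, T]`, so the identity holds at
all nodes, end points included. -/
theorem IsContinuousRepresentative.sub_eq_integral_weakDeriv (hT : 0 < T) (hp : 1 ≤ p)
    (hg : MemSlobodeckij σ p T g) {f : ℝ → ℝ} (hf : IsContinuousRepresentative T g f)
    {s t : ℝ} (hs : s ∈ Set.Icc 0 T) (ht : t ∈ Set.Icc 0 T) :
    f t - f s = ∫ x in s..t, weakDeriv T g x := by
  have hw := hg.integrableOn_weakDeriv hp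
  obtain ⟨c, hc⟩ := (hasWeakDeriv_weakDeriv hg.2.1).exists_ae_eq_const_add_integral hT
    (hg.integrableOn hp) hw
  have h := hf.2.trans hc
  rw [restrict_Ioo_eq_restrict_Icc] at h
  have heq := Measure.eqOn_Icc_of_ae_eq volume hT.ne h hf.1
    (continuousOn_const_add_integral hT hw c)
  rw [heq hs, heq ht, add_sub_add_left_eq_sub]
  have hi : ∀ x ∈ Set.Icc 0 T, IntervalIntegrable (weakDeriv T g) volume 0 x := fun x hx =>
    (intervalIntegrable_iff_integrableOn_Ioo_of_le hx.1).2
      (hw.mono_set (Set.Ioo_subset_Ioo_right hx.2))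
  exact intervalIntegral.integral_interval_sub_left (hi t ht) (hi s hs)

end Slobodeckij

theorem IsContinuousRepresentative.eLpNorm_sub_trapezoidalRule_le {Ω : Type*}
    {mΩ : MeasurableSpace Ω} {P : Measure Ω} [IsProbabilityMeasure P] {T : ℝ}
    {𝓕 : Filtration ℝ mΩ} {W : ℝ → Ω → ℝ} {p σ θ : ℝ} {g f : ℝ → ℝ} (hT : 0 < T)
    (hW : IsWienerProcessOn T 𝓕 W P) (hp : 2 ≤ p) (hσ : 0 < σ) (hθ : θ ∈ Set.Icc (0 : ℝ) 1)
    (hg : MemSlobodeckij σ p T g) (hf : IsContinuousRepresentative T g f) {N : ℕ} (hN : 0 < N) :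
    eLpNorm (fun ω => itoIntegral 𝓕 W P 0 T (fun t _ => g t) ω -
        trapezoidalRule 𝓕 W P T θ N f ω) (ENNReal.ofReal p) P ≤
      ENNReal.ofReal (√p * (T ^ ((p - 2) / (2 * p)) * (T / N) ^ (1 + σ))) *
        slobodeckijNorm σ p T g := by
  have hp0 : 0 < p := by linarith
  have hp1 : 1 ≤ p := by linarith
  set w := weakDeriv T g with hw
  have hwi : IntegrableOn w (Set.Ioo 0 T) := hg.integrableOn_weakDeriv hp1
  set F : ℝ → ℝ → ENNReal := fun s t =>
    ENNReal.ofReal (|w t - w s| ^ p / |t - s| ^ (1 + σ * p)) with hF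
  set A := ∫⁻ s in Set.Ioo 0 T, ∫⁻ t in Set.Ioo 0 T, F s t with hA
  have hAt : A < ⊤ := (ENNReal.add_lt_top.1 (hg.sum_lt_top hp0)).2
  set E : ℕ → ENNReal := fun j => ∫⁻ s in Set.Ioc (gridPoint T N j) (gridPoint T N (j + 1)),
    ∫⁻ t in Set.Ioc (gridPoint T N j) (gridPoint T N (j + 1)), F s t with hE
  have hEA : ∑ j ∈ Finset.range N, E j ≤ A := sum_lintegral_cell_le hT hN F
  -- Finiteness lets the cell estimates pass from `ENNReal` to real numbers.
  have hEt : ∀ j < N, E j < ⊤ := fun j hj =>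
    ((Finset.single_le_sum (fun _ _ => zero_le) (Finset.mem_range.2 hj)).trans hEA).trans_lt hAt
  have hsum : ∑ j ∈ Finset.range N, (E j).toReal ≤ A.toReal := by
    rw [← ENNReal.toReal_sum fun j hj => (hEt j (Finset.mem_range.1 hj)).ne]
    exact ENNReal.toReal_mono hAt.ne hEA
  have hB := sum_mul_sq_rpow_le (σ := σ) hT hp hN (fun j => (E j).toReal_nonneg) hsum
  have hD : ∀ j < N, ∀ t ∈ Set.Icc (gridPoint T N j) (gridPoint T N (j + 1)),
      |f t - (1 / 2 * (f (gridPoint T N j + θ * (T / N)) +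
          f (gridPoint T N j + (1 - θ) * (T / N))) +
        1 / (T / N) * (f (gridPoint T N (j + 1)) - f (gridPoint T N j)) *
          (t - (gridPoint T N j + gridPoint T N (j + 1)) / 2))| ≤
      (T / N) ^ (1 + σ - 1 / p) * (E j).toReal ^ (1 / p) := by
    intro j hj t ht
    have hsub : Set.Icc (gridPoint T N j) (gridPoint T N (j + 1)) ⊆ Set.Icc 0 T :=
      Set.Icc_subset_Icc (gridPoint_nonneg hT.le _ _) (gridPoint_le hT.le hN hj)
    have h := abs_sub_interpolation_le (p := p) (σ := σ) (f := f) (w := w)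
      (gridPoint_lt_succ hT hN j) hp1 hσ hθ
      (((integrableOn_Icc_iff_integrableOn_Ioo).2 hwi).mono_set
        (Set.Ioc_subset_Icc_self.trans hsub))
      (fun s hs t ht => hf.sub_eq_integral_weakDeriv hT hp1 hg (hsub hs) (hsub ht)) ht
    rw [gridPoint_succ_sub] at h
    change _ ≤ ENNReal.ofReal ((T / N) ^ (1 + σ - 1 / p)) * E j ^ (1 / p) at h
    rw [← ENNReal.ofReal_toReal (hEt j hj).ne, ENNReal.ofReal_rpow_of_nonneg ENNReal.toReal_nonneg
      (by positivity), ← ENNReal.ofReal_mul (by positivity)] at h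
    exact (ENNReal.ofReal_le_ofReal_iff (by positivity)).1 h
  have hfg : f =ᵐ[volume.restrict (Set.Ioc 0 T)] g := by
    rw [← restrict_Ioo_eq_restrict_Ioc]; exact hf.2
  refine (hW.eLpNorm_itoIntegral_sub_affine_le hT hp hN hf.1 hfg (by positivity) hD hB).trans ?_
  rw [mul_comm ((T / N) ^ (1 + σ)), ← mul_assoc, ENNReal.ofReal_mul (by positivity),
    ← ENNReal.ofReal_rpow_of_nonneg ENNReal.toReal_nonneg (by positivity),
    ENNReal.ofReal_toReal hAt.ne]
  gcongr
  rw [slobodeckijNorm]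
  -- Only the double integral in the norm is used; the other two summands are dropped.
  exact ENNReal.rpow_le_rpow le_add_self (by positivity)

theorem mainTheorem2 :
    ∃ C : ℝ → ℝ,
      (∀ p : ℝ, 2 ≤ p → 0 < C p ∧ ∀ K : ℝ, IsUpperBDGConstant p K → C p ≤ K) ∧
      ∀ (Ω : Type*) (mΩ : MeasurableSpace Ω) (P : Measure Ω) (_ : IsProbabilityMeasure P)
        (T : ℝ) (𝓕 : Filtration ℝ mΩ) (W : ℝ → Ω → ℝ) (p σ θ : ℝ) (g : ℝ → ℝ),
        0 < T → IsWienerProcessOn T 𝓕 W P →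
        2 ≤ p → σ ∈ Set.Ioo (0 : ℝ) 1 → θ ∈ Set.Icc (0 : ℝ) 1 →
        MemSlobodeckij σ p T g →
        (∃ f : ℝ → ℝ, IsContinuousRepresentative T g f) ∧
        ItoIntegrable 𝓕 W P 0 T (fun t _ => g t) ∧
        ∀ f : ℝ → ℝ, IsContinuousRepresentative T g f → ∀ N : ℕ, 0 < N →
          (∀ j < N, ItoIntegrable 𝓕 W P (gridPoint T N j) (gridPoint T N (j + 1))
            (fun t _ => t - (gridPoint T N j + gridPoint T N (j + 1)) / 2)) ∧
          eLpNorm (fun ω => itoIntegral 𝓕 W P 0 T (fun t _ => g t) ω -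
              trapezoidalRule 𝓕 W P T θ N f ω) (ENNReal.ofReal p) P ≤
            ENNReal.ofReal (C p * (2 * p * (p - 1)) ^ (1 / 2 : ℝ) * T ^ ((p - 2) / (2 * p)) *
              (T / N) ^ (1 + σ)) * slobodeckijNorm σ p T g := by
  refine ⟨fun _ => 1, fun p hp => ⟨one_pos, fun K hK => hK.one_le (by linarith)⟩, ?_⟩
  intro Ω mΩ P _ T 𝓕 W p σ θ g hT hW hp hσ hθ hg
  have hp1 : 1 ≤ p := by linarith
  obtain ⟨f₀, hf₀⟩ := hg.exists_isContinuousRepresentative hT hp1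
  refine ⟨⟨f₀, hf₀⟩, ?_, fun f hf N hN => ⟨fun j hj => ?_, ?_⟩⟩
  · refine itoIntegrable_of_ae_eq_continuousOn hW le_rfl hT.le le_rfl hf₀.1 ?_
    rw [← restrict_Ioo_eq_restrict_Ioc]
    exact hf₀.2
  · exact itoIntegrable_of_ae_eq_continuousOn
      (f := fun t => t - (gridPoint T N j + gridPoint T N (j + 1)) / 2) hW
      (gridPoint_nonneg hT.le N j) (gridPoint_lt_succ hT hN j).le (gridPoint_le hT.le hN hj)
      (by fun_prop) EventuallyEq.rfl
  · refine (hf.eLpNorm_sub_trapezoidalRule_le hT hW hp hσ.1 hθ hg hN).trans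
      (mul_le_mul' (ENNReal.ofReal_le_ofReal ?_) le_rfl)
    rw [one_mul, ← Real.sqrt_eq_rpow, mul_assoc]
    -- What remains is `p ≤ 2p(p-1)`, true because `2(p-1) ≥ 1`.
    refine mul_le_mul_of_nonneg_right (Real.sqrt_le_sqrt ?_) (by positivity)
    nlinarith
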